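/- Let $T$ be a complete first-order theory with NIP and let $\mathfrak C\models T$ be a monster model, i.e. $\mathfrak C$ is $\kappa$-saturated and strongly $\kappa$-homogeneous for some strong limit cardinal $\kappa>|T|$; "small" means of cardinality $<\kappa$. Let $\lambda$ range over small cardinals and $E$ over equivalence relations on $\mathfrak C^\lambda$ that are $\emptyset$-type-definable, i.e. defined by a (possibly infinite) set of formulas without parameters. Elements of $\mathfrak C^\lambda/E$ are called hyperimaginaries, and two finite sequences of elements of $\mathfrak C^\lambda/E$ have the same type over $\emptyset$ if some automorphism of $\mathfrak C$ maps one to the other; two finite sequences of tuples have the same type over $\emptyset$ if they satisfy the same formulas without parameters. A sequence $(e_i)_{i\in\mathcal I}$ (of tuples, or of elements of $\mathfrak C^\lambda/E$), indexed by a small linear order $\mathcal I$, is indiscernible if for every $n$ all the finite sequences $(e_{i_1},\dots,e_{i_n})$ with $i_1<\dots<i_n$ have the same type over $\emptyset$; it is dense if $\mathcal I$ is a dense linear order. A cut of $I=(e_i)_{i\in\mathcal I}$ is a decomposition $I=I_1+I_2$ into an initial segment and the complementary end segment; it is Dedekind if $I_1$ and the reverse of $I_2$ both have infinite cofinality. An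 element $b$ of the same sort fills the cut if $I_1+b+I_2$ is indiscernible. A dense indiscernible sequence $I$ is distal if for any distinct Dedekind cuts $\mathfrak c_1,\mathfrak c_2$ of $I$, say $\mathfrak c_1$ to the left of $\mathfrak c_2$, which decompose $I$ as $I_1+I_2+I_3$, and for any $b$ filling $\mathfrak c_1$ and $d$ filling $\mathfrak c_2$, the sequence $I_1+b+I_2+d+I_3$ is indiscernible. The theory $T$ is distal if every dense indiscernible sequence of finite tuples from $\mathfrak C$ is distal, and $T^{heq}$ is distal if for all $\lambda$ and $E$ as above every dense indiscernible sequence of elements of $\mathfrak C^\lambda/E$ is distal. Theorem. (1) If $(a_i)_{i\in\mathcal I}$ is a dense distal indiscernible sequence of tuples from $\mathfrak C^\lambda$, with $\lambda$ small, then for every $\emptyset$-type-definable equivalence relation $E$ on $\mathfrak C^\lambda$ the sequence $(a_i/E)_{i\in\mathcal I}$ of hyperimaginaries is (indiscernible and) distal. (2) If $T$ is distal, then $T^{heq}$ is distal. -/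

import Mathlib

open FirstOrder Cardinal

universe u v w

namespace HyperDistal

/-! ### Sequences, cuts and distality

The notions below are the same for sequences of tuples and for sequences of hyperimaginaries.
They are stated for a set `S` of elements with a relation `te`, where `te n x y` says that the
`n`-tuples `x`, `y` of elements of `S` have the same type over the empty set. -/

section Sequences

variable {S : Type*} {I J : Type*} [LinearOrder I] [LinearOrder J]

/-- A sequence `a` is indiscernible if all its increasing `n`-tuples have the same type over the
empty set, for every `n`. -/
def Indiscernible (te : ∀ n : ℕ, (Fin n → S) → (Fin n → S) → Prop) (a : I → S) : Prop :=
  ∀ (n : ℕ) (i j : Fin n ↪o I), te n (fun k => a (i k)) (fun k => a (j k))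

/-- The concatenation `f + g` of two sequences; `I ⊕ₗ J` is the order `I` followed by `J`. -/
def concat (f : I → S) (g : J → S) : I ⊕ₗ J → S :=
  fun x => Sum.elim f g (ofLex x)

/-- The one-term sequence. -/
def single (b : S) : Unit → S := fun _ => b

/-- The subsequence of `a` with index set `C`. -/
def restrictTo (a : I → S) (C : Set I) : C → S := fun i => a i

/-- A cut `(C, Cᶜ)` of the index set, given by its left part `C`, is Dedekind if `C` and the
reverse of `Cᶜ` both have infinite cofinality, that is, `C` is non-empty without a greatest element
and `Cᶜ` is non-empty without a least element. -/
structure IsDedekindCut (C : Set I) : Prop where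
  lower : IsLowerSet C
  left_nonempty : C.Nonempty
  left_no_max : ∀ i ∈ C, ∃ j ∈ C, i < j
  right_nonempty : Cᶜ.Nonempty
  right_no_min : ∀ i ∈ Cᶜ, ∃ j ∈ Cᶜ, j < i

/-- `b` fills the cut `(C, Cᶜ)` of `a`: the sequence `I₁ + b + I₂` is indiscernible. -/
def Fills (te : ∀ n : ℕ, (Fin n → S) → (Fin n → S) → Prop) (a : I → S) (C : Set I) (b : S) :
    Prop :=
  Indiscernible te (concat (restrictTo a C) (concat (single b) (restrictTo a Cᶜ)))

/-- A sequence is distal if it is indiscernible and, for any two distinct Dedekind cuts, the left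
one filled by `b` and the right one filled by `d`, the sequence `I₁ + b + I₂ + d + I₃` is
indiscernible. (Of two distinct cuts one is always to the left of the other.) This is used for
densely ordered `I`. -/
def IsDistal (te : ∀ n : ℕ, (Fin n → S) → (Fin n → S) → Prop) (a : I → S) : Prop :=
  Indiscernible te a ∧
  ∀ C D : Set I, IsDedekindCut C → IsDedekindCut D → C ⊂ D →
    ∀ b d : S, Fills te a C b → Fills te a D d →
      Indiscernible te
        (concat (restrictTo a C) (concat (single b)
          (concat (restrictTo a (D \ C)) (concat (single d) (restrictTo a Dᶜ)))))

end Sequences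

/-! ### Monster models, NIP, types of tuples and of hyperimaginaries -/

section Models

variable (L : FirstOrder.Language.{u, v}) (M : Type w) [L.Structure M]

/-- Every finitely satisfiable set of formulas in one variable with fewer than `κ` parameters is
realized in `M`. -/
def IsSaturated (κ : Cardinal.{w}) : Prop :=
  ∀ A : Set M, #A < κ → ∀ p : Set (L[[A]].Formula Unit),
    (∀ F : Finset (L[[A]].Formula Unit), (F : Set (L[[A]].Formula Unit)) ⊆ p →
      ∃ x : M, ∀ φ ∈ F, φ.Realize (fun _ => x)) →
    ∃ x : M, ∀ φ ∈ p, φ.Realize (fun _ => x)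

/-- Every partial elementary map of `M` with domain of size less than `κ` extends to an
automorphism of `M`. -/
def IsStronglyHomogeneous (κ : Cardinal.{w}) : Prop :=
  ∀ A : Set M, #A < κ → ∀ f : A → M,
    (∀ φ : L.Formula A, φ.Realize (fun a : A => (a : M)) ↔ φ.Realize f) →
    ∃ σ : M ≃[L] M, ∀ a : A, σ a = f a

/-- `M` is a monster model (of its complete theory `T`): it is `κ`-saturated and strongly
`κ`-homogeneous for a strong limit cardinal `κ > |T|`, where `|T|` is the number of formulas, that
is, the maximum of `ℵ₀` and the cardinality of the language. -/
structure IsMonster (κ : Cardinal.{w}) : Prop where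
  strongLimit : κ.IsStrongLimit
  aleph0_lt : ℵ₀ < κ
  card_lt : Cardinal.lift.{w} L.card < Cardinal.lift.{max u v} κ
  saturated : IsSaturated L M κ
  homogeneous : IsStronglyHomogeneous L M κ

/-- The complete theory of `M` has NIP: for every formula `φ(x; y)` there is some `n` such that
`φ` shatters no family of `n` parameters. -/
def HasNIP : Prop :=
  ∀ (k l : ℕ) (φ : L.Formula (Fin k ⊕ Fin l)), ∃ n : ℕ,
    ¬ ∃ (b : Fin n → Fin l → M) (a : Set (Fin n) → Fin k → M),
      ∀ (s : Set (Fin n)) (i : Fin n), φ.Realize (Sum.elim (a s) (b i)) ↔ i ∈ s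

variable {M} {α : Type*}

/-- Two `n`-tuples of elements of `M^α` have the same (first-order) type over the empty set. -/
def TupleTypeEq (n : ℕ) (x y : Fin n → α → M) : Prop :=
  ∀ φ : L.Formula (Fin n × α),
    φ.Realize (fun q => x q.1 q.2) ↔ φ.Realize (fun q => y q.1 q.2)

/-- The equivalence relation `E` on `M^α` is type-definable over the empty set. -/
def TypeDefinable (E : Setoid (α → M)) : Prop :=
  ∃ p : Set (L.Formula (α ⊕ α)), ∀ x y : α → M, E x y ↔ ∀ φ ∈ p, φ.Realize (Sum.elim x y)

/-- Two `n`-tuples `x`, `y` of elements of `M^α / E` have the same type over the empty set: some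
automorphism of `M` maps the class `x k` to the class `y k`, for every `k`. (A relation `E` that is
type-definable over the empty set is invariant under automorphisms, so these act on `M^α / E`.) -/
def HypTypeEq (E : Setoid (α → M)) (n : ℕ) (x y : Fin n → Quotient E) : Prop :=
  ∃ σ : M ≃[L] M, ∀ (k : Fin n) (r : α → M),
    Quotient.mk E r = x k → Quotient.mk E (fun c => σ (r c)) = y k

variable (M)

/-- The complete theory of the monster model `M` is distal: every dense indiscernible sequence
(with small index set) of finite tuples is distal. -/
def IsDistalTheory (κ : Cardinal.{w}) : Prop :=
  ∀ (m : ℕ) (I : Type w) [LinearOrder I] [DenselyOrdered I], #I < κ →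
    ∀ a : I → Fin m → M,
      Indiscernible (TupleTypeEq L) a → IsDistal (TupleTypeEq L) a

/-- `T^heq` is distal, for the complete theory `T` of the monster model `M`: for every small `α`
and every equivalence relation `E` on `M^α` type-definable over the empty set, every dense
indiscernible sequence (with small index set) of elements of `M^α / E` is distal. -/
def IsDistalHeq (κ : Cardinal.{w}) : Prop :=
  ∀ α : Type w, #α < κ → ∀ E : Setoid (α → M), TypeDefinable L E →
    ∀ (I : Type w) [LinearOrder I] [DenselyOrdered I], #I < κ →
      ∀ e : I → Quotient E,
        Indiscernible (HypTypeEq L E) e → IsDistal (HypTypeEq L E) e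

end Models

end HyperDistal

/-!
The quotient `e` of a distal sequence `a` is indiscernible. Let `b`, `d` fill two cuts of `e`. If
both lift to fillers of the same cuts in one sequence `a'` of representatives of `e`, where `a'` is
conjugate to `a`, then distality of `a'` gives an indiscernible sequence of tuples whose quotient is
`e` with `b` and `d` inserted, and the first part follows (`IsDistal.quotient`).

Each filler lifts separately, by compactness. That both lift to the same sequence
(`exists_common_lift`) is where NIP enters, as in the proof of strong base change for indiscernible
sequences. By compactness it suffices to satisfy finitely many formulas, whose parameters come from
terms of `a` away from the cuts (`exists_base_change`). If they cannot be satisfied, then for every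
pair of fillers conjugate to `b`, `d` over these terms, one of the two fillers violates a formula
true of all terms near the corresponding cut. The violating filler is added to `e`, which stays
indiscernible because only this one is added, and the same is done with the extended sequence in
place of `e`. After finitely many rounds one cut has collected many violations, separated by terms
of `e`. The extended sequence is the quotient of an indiscernible sequence of tuples, so a formula
alternates often on an indiscernible sequence, against NIP
(`HasNIP.exists_alternation_bound`).

For the second part, an indiscernible sequence of hyperimaginaries has an indiscernible sequence of
representatives, by Ramsey's theorem and compactness (`exists_indiscernible_lift`). Since a formula
has finitely many variables, the distality of sequences of finite tuples passes to it
(`IsDistalTheory.isDistal`), and the first part applies.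
-/

namespace HyperDistal

/-! ### Properties expressed by formulas -/

section Formulas

variable (L : FirstOrder.Language.{u, v}) {M : Type w} [L.Structure M]

/-- A property of assignments of values to the variables in `δ` that is expressed by a formula
without parameters. -/
def IsFormula {δ : Type*} (P : (δ → M) → Prop) : Prop :=
  ∃ φ : L.Formula δ, ∀ v, φ.Realize v ↔ P v

variable {L} {δ ε β : Type*}

theorem isFormula_realize (φ : L.Formula δ) : IsFormula L (fun v : δ → M => φ.Realize v) :=
  ⟨φ, fun _ => Iff.rfl⟩

theorem IsFormula.reindex {P : (δ → M) → Prop} (hP : IsFormula L P) (h : δ → ε) :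
    IsFormula L (fun v : ε → M => P (fun z => v (h z))) := by
  obtain ⟨φ, hφ⟩ := hP
  refine ⟨φ.relabel h, fun v => ?_⟩
  rw [FirstOrder.Language.Formula.realize_relabel, hφ]
  rfl

theorem IsFormula.and {P Q : (δ → M) → Prop} (hP : IsFormula L P) (hQ : IsFormula L Q) :
    IsFormula L (fun v => P v ∧ Q v) := by
  obtain ⟨φ, hφ⟩ := hP
  obtain ⟨ψ, hψ⟩ := hQ
  exact ⟨φ ⊓ ψ, fun v => by rw [FirstOrder.Language.Formula.realize_inf, hφ, hψ]⟩

theorem IsFormula.iff {P Q : (δ → M) → Prop} (hP : IsFormula L P) (hQ : IsFormula L Q) :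
    IsFormula L (fun v => P v ↔ Q v) := by
  obtain ⟨φ, hφ⟩ := hP
  obtain ⟨ψ, hψ⟩ := hQ
  exact ⟨φ.iff ψ, fun v => by rw [FirstOrder.Language.Formula.realize_iff, hφ, hψ]⟩

theorem IsFormula.forall_mem {K : Type*} {P : K → (δ → M) → Prop}
    (hP : ∀ k, IsFormula L (P k)) (F : Finset K) : IsFormula L (fun v => ∀ k ∈ F, P k v) := by
  choose φ hφ using hP
  refine ⟨FirstOrder.Language.Formula.iInf (fun k : F => φ k), fun v => ?_⟩
  rw [FirstOrder.Language.Formula.realize_iInf]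
  simp [hφ]

theorem isFormula_const (p : Prop) : IsFormula L (fun _ : δ → M => p) := by
  by_cases h : p
  · exact ⟨⊤, fun v => by simp [h]⟩
  · exact ⟨⊥, fun v => by simp [h]⟩

/-- A formula depends on finitely many variables only. -/
theorem IsFormula.exists_support {P : (δ → M) → Prop} (hP : IsFormula L P) :
    ∃ V : Finset δ, ∀ v v' : δ → M, Set.EqOn v v' V → (P v ↔ P v') := by
  classical
  obtain ⟨φ, hφ⟩ := hP
  have key : ∀ v : δ → M, (φ.restrictFreeVar (fun x => (x : δ))).Realize v default ↔ P v :=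
    fun v => by
      rw [← hφ]
      exact FirstOrder.Language.BoundedFormula.realize_restrictFreeVar v (fun _ => rfl)
  refine ⟨φ.freeVarFinset, fun v v' h => ?_⟩
  rw [← key v, ← hφ v']
  exact FirstOrder.Language.BoundedFormula.realize_restrictFreeVar v' (fun a => h a.2)

/-- Formulas are closed under quantification over an arbitrary, possibly infinite, family of
variables, since only finitely many of them occur. -/
theorem IsFormula.exists [Nonempty M] {P : (δ ⊕ β → M) → Prop} (hP : IsFormula L P) :
    IsFormula L (fun v : δ → M => ∃ x : β → M, P (Sum.elim v x)) := by
  classical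
  obtain ⟨φ, hφ⟩ := hP
  let f : φ.freeVarFinset → δ ⊕ φ.freeVarFinset := fun z =>
    match z with
    | ⟨Sum.inl d, _⟩ => Sum.inl d
    | z => Sum.inr z
  let ψ : L.Formula (δ ⊕ φ.freeVarFinset) := φ.restrictFreeVar f
  refine ⟨ψ.iExs _, fun v => ?_⟩
  rw [FirstOrder.Language.Formula.realize_iExs]
  constructor
  · rintro ⟨i, hi⟩
    refine ⟨fun b => if h : Sum.inr b ∈ φ.freeVarFinset then i ⟨_, h⟩
      else Classical.arbitrary M, ?_⟩
    rw [← hφ]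
    refine (FirstOrder.Language.BoundedFormula.realize_restrictFreeVar _ ?_).1 hi
    rintro ⟨d | b, h⟩
    · rfl
    · simp [f, h]
  · rintro ⟨x, hx⟩
    refine ⟨fun z => Sum.elim v x z, ?_⟩
    rw [← hφ] at hx
    refine (FirstOrder.Language.BoundedFormula.realize_restrictFreeVar (Sum.elim v x) ?_).2 hx
    rintro ⟨d | b, h⟩ <;> rfl

theorem IsFormula.iff_aut {P : (δ → M) → Prop} (hP : IsFormula L P) (σ : M ≃[L] M) (v : δ → M) :
    P (fun z => σ (v z)) ↔ P v := by
  obtain ⟨φ, hφ⟩ := hP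
  rw [← hφ, ← hφ]
  exact FirstOrder.Language.StrongHomClass.realize_formula σ φ

end Formulas

/-! ### Saturation and homogeneity in many variables -/

section Saturation

variable {L : FirstOrder.Language.{u, v}} {M : Type w} [L.Structure M]

/-- One step of the construction in `IsSaturated.exists_forall`: a further variable `x` is given a
value. -/
theorem IsSaturated.exists_extension [Nonempty M] {κ : Cardinal.{w}} (hs : IsSaturated L M κ)
    {δ : Type w} (hδ : #δ < κ) {K : Type*} {P : K → (δ → M) → Prop} (hP : ∀ k, IsFormula L (P k))
    (B : Set δ) (f : δ → M)
    (fip : ∀ F : Finset K, ∃ v : δ → M, Set.EqOn v f B ∧ ∀ k ∈ F, P k v) {x : δ} (hx : x ∉ B) :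
    ∃ m : M, ∀ F : Finset K, ∃ v : δ → M, Set.EqOn v f B ∧ v x = m ∧ ∀ k ∈ F, P k v := by
  classical
  let A : Set M := f '' B
  have hA : #A < κ := (mk_image_le.trans (mk_set_le B)).trans_lt hδ
  -- Variables in `B` become constants, `x` becomes the free variable, the others are quantified.
  let h : δ → (A ⊕ Unit) ⊕ δ := fun z =>
    if hz : z ∈ B then Sum.inl (Sum.inl ⟨f z, z, hz, rfl⟩)
    else if z = x then Sum.inl (Sum.inr ()) else Sum.inr z
  have key : ∀ F : Finset K, ∃ ψ : L[[A]].Formula Unit, ∀ m : M, ψ.Realize (fun _ => m) ↔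
      ∃ v : δ → M, Set.EqOn v f B ∧ v x = m ∧ ∀ k ∈ F, P k v := by
    intro F
    obtain ⟨ψ, hψ⟩ := ((IsFormula.forall_mem hP F).reindex h).exists
    refine ⟨FirstOrder.Language.BoundedFormula.constantsVarsEquiv.symm ψ, fun m => ?_⟩
    have h1 := FirstOrder.Language.BoundedFormula.realize_constantsVarsEquiv (M := M) (L := L)
      (φ := FirstOrder.Language.BoundedFormula.constantsVarsEquiv.symm ψ)
      (v := fun _ : Unit => m) (xs := default)
    rw [Equiv.apply_symm_apply] at h1
    refine h1.symm.trans ((hψ _).trans ?_)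
    constructor
    · rintro ⟨y, hy⟩
      refine ⟨_, ?_, ?_, hy⟩
      · intro z hz
        simp [h, hz]
      · simp [h, hx]
    · rintro ⟨y, hy, hyx, hyP⟩
      refine ⟨y, fun k hk => ?_⟩
      convert hyP k hk using 2 with z
      by_cases hz : z ∈ B
      · simp [h, hz, hy hz]
      · by_cases hzx : z = x
        · subst hzx; simp [h, hz, hyx]
        · simp [h, hz, hzx]
  choose ψ hψ using key
  obtain ⟨m, hm⟩ := hs A hA (Set.range ψ) (by
    intro G hG
    obtain ⟨s, -, rfl⟩ := Finset.subset_set_image_iff.1 (Set.image_univ ▸ hG)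
    obtain ⟨v, hvf, hv⟩ := fip (s.biUnion id)
    refine ⟨v x, fun φ hφ => ?_⟩
    obtain ⟨F, hF, rfl⟩ := Finset.mem_image.1 hφ
    exact (hψ F _).2 ⟨v, hvf, rfl, fun k hk => hv k (Finset.mem_biUnion.2 ⟨F, hF, hk⟩)⟩)
  exact ⟨m, fun F => (hψ F m).1 (hm _ ⟨F, rfl⟩)⟩

/-- Saturation for types in a small family of variables, some of which, those in `B`, have
prescribed values. -/
theorem IsSaturated.exists_forall [Nonempty M] {κ : Cardinal.{w}} (hs : IsSaturated L M κ)
    {δ : Type w} (hδ : #δ < κ) {K : Type*} {P : K → (δ → M) → Prop} (hP : ∀ k, IsFormula L (P k))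
    (B : Set δ) (f : δ → M)
    (fip : ∀ F : Finset K, ∃ v : δ → M, Set.EqOn v f B ∧ ∀ k ∈ F, P k v) :
    ∃ v : δ → M, Set.EqOn v f B ∧ ∀ k, P k v := by
  classical
  -- The states are partial assignments `(domain, values)` under which every finite part of the type
  -- is still satisfiable; the values outside the domain are irrelevant.
  let St := {s : Set δ × (δ → M) //
    ∀ F : Finset K, ∃ v : δ → M, Set.EqOn v s.2 s.1 ∧ ∀ k ∈ F, P k v}
  let r : St → St → Prop := fun s t => s.1.1 ⊆ t.1.1 ∧ Set.EqOn s.1.2 t.1.2 s.1.1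
  let s₀ : St := ⟨(B, f), fip⟩
  have hrefl : ∀ s, r s s := fun s => ⟨subset_rfl, fun _ _ => rfl⟩
  have htrans : ∀ {s t t' : St}, r s t → r t t' → r s t' := fun h1 h2 =>
    ⟨h1.1.trans h2.1, fun z hz => (h1.2 hz).trans (h2.2 (h1.1 hz))⟩
  obtain ⟨t, ht⟩ := exists_maximal_of_chains_bounded (α := {s : St // r s₀ s})
    (r := fun s t => r s.1 t.1) (by
    intro c hc
    rcases c.eq_empty_or_nonempty with rfl | hne
    · exact ⟨⟨s₀, hrefl _⟩, by simp⟩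
    let U : Set δ := ⋃ s ∈ c, s.1.1.1
    let g : δ → M := fun z =>
      if h : ∃ s ∈ c, z ∈ s.1.1.1 then h.choose.1.1.2 z else Classical.arbitrary M
    have hg : ∀ s ∈ c, Set.EqOn s.1.1.2 g s.1.1.1 := by
      intro s hs z hz
      have h : ∃ s ∈ c, z ∈ s.1.1.1 := ⟨s, hs, hz⟩
      have e : g z = h.choose.1.1.2 z := dif_pos h
      rw [e]
      rcases eq_or_ne s h.choose with e' | e'
      · rw [← e']
      · rcases hc hs h.choose_spec.1 e' with h' | h'
        · exact h'.2 hz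
        · exact (h'.2 h.choose_spec.2).symm
    have hgood : ∀ F : Finset K, ∃ v : δ → M, Set.EqOn v g U ∧ ∀ k ∈ F, P k v := by
      intro F
      -- Only the finitely many variables in `V` matter, and one member of the chain covers those
      -- that lie in `U`.
      obtain ⟨V, hV⟩ := (IsFormula.forall_mem hP F).exists_support
      have hVU : ((V.filter (· ∈ U) : Finset δ) : Set δ) ⊆ ⋃ s ∈ c, s.1.1.1 := by
        intro z hz
        exact (Finset.mem_filter.1 hz).2
      obtain ⟨s, hsc, hsV⟩ := DirectedOn.exists_mem_subset_of_finset_subset_biUnion hne (by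
        intro s hs t ht
        rcases eq_or_ne s t with rfl | e
        · exact ⟨s, hs, subset_rfl, subset_rfl⟩
        · rcases hc hs ht e with h | h
          · exact ⟨t, ht, h.1, subset_rfl⟩
          · exact ⟨s, hs, subset_rfl, h.1⟩) hVU
      obtain ⟨v, hv, hvP⟩ := s.1.2 F
      refine ⟨fun z => if z ∈ U then g z else v z, fun z hz => if_pos hz, ?_⟩
      refine (hV _ v ?_).2 hvP
      intro z hz
      by_cases hzU : z ∈ U
      · have hzs : z ∈ s.1.1.1 := hsV (by simpa using ⟨hz, hzU⟩)
        simp only [hzU, if_true]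
        rw [← hg s hsc hzs, hv hzs]
      · simp [hzU]
    have hub : ∀ s ∈ c, r s.1 ⟨(U, g), hgood⟩ := fun s hs =>
      ⟨Set.subset_biUnion_of_mem (u := fun s : {s : St // r s₀ s} => s.1.1.1) hs, hg s hs⟩
    obtain ⟨s, hs⟩ := hne
    exact ⟨⟨⟨(U, g), hgood⟩, htrans s.2 (hub s hs)⟩, hub⟩) htrans
  obtain ⟨⟨⟨D, g⟩, hgood⟩, h0⟩ := t
  have hD : D = Set.univ := by
    by_contra hne
    obtain ⟨x, hx⟩ := (Set.ne_univ_iff_exists_notMem _).1 hne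
    obtain ⟨m, hm⟩ := hs.exists_extension hδ hP D g hgood hx
    have hgood' : ∀ F : Finset K, ∃ v : δ → M,
        Set.EqOn v (Function.update g x m) (insert x D) ∧ ∀ k ∈ F, P k v := by
      intro F
      obtain ⟨v, hv, hvx, hvP⟩ := hm F
      refine ⟨v, ?_, hvP⟩
      rintro z (rfl | hz)
      · simp [hvx]
      · rw [Function.update_of_ne (by rintro rfl; exact hx hz), hv hz]
    have hr : r ⟨(D, g), hgood⟩ ⟨(insert x D, Function.update g x m), hgood'⟩ :=
      ⟨Set.subset_insert _ _, fun z hz =>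
        (Function.update_of_ne (by rintro rfl; exact hx hz) _ _).symm⟩
    exact hx ((ht ⟨_, htrans h0 hr⟩ hr).1 (Set.mem_insert _ _))
  subst hD
  refine ⟨g, fun z hz => (h0.2 hz).symm, fun k => ?_⟩
  obtain ⟨v, hv, hvP⟩ := hgood {k}
  have : v = g := funext fun z => hv (Set.mem_univ z)
  exact this ▸ hvP k (by simp)

/-- Strong homogeneity for small families of elements. -/
theorem IsStronglyHomogeneous.exists_aut {κ : Cardinal.{w}} (hh : IsStronglyHomogeneous L M κ)
    {β : Type w} (hβ : #β < κ) (x y : β → M)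
    (h : ∀ φ : L.Formula β, φ.Realize x ↔ φ.Realize y) :
    ∃ σ : M ≃[L] M, ∀ z, σ (x z) = y z := by
  classical
  have hA : #(Set.range x) < κ := mk_range_le.trans_lt hβ
  let g : Set.range x → β := fun m => m.2.choose
  have hg : ∀ m, x (g m) = m := fun m => m.2.choose_spec
  obtain ⟨σ, hσ⟩ := hh (Set.range x) hA (fun m => y (g m)) (by
    intro φ
    have := h (φ.relabel g)
    rw [FirstOrder.Language.Formula.realize_relabel,
      FirstOrder.Language.Formula.realize_relabel] at this
    have e : (fun m : Set.range x => (m : M)) = x ∘ g := funext fun m => (hg m).symm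
    rw [e]
    exact this)
  refine ⟨σ, fun z => ?_⟩
  rw [hσ ⟨x z, z, rfl⟩]
  -- `g` picks one index for each value, possibly not `z`; but equalities are part of the type.
  have := h (FirstOrder.Language.Term.equal (FirstOrder.Language.Term.var (g ⟨x z, z, rfl⟩))
    (FirstOrder.Language.Term.var z))
  simp only [FirstOrder.Language.Formula.realize_equal,
    FirstOrder.Language.Term.realize_var] at this
  exact this.1 (hg _)

end Saturation

/-! ### Sequences with one inserted term -/

section Orders

variable {S : Type*} {I J : Type*} [LinearOrder I] [LinearOrder J]

theorem exists_strictMono_mem_Ioo [DenselyOrdered I] {u v : I} (h : u < v) :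
    ∃ l : ℕ → I, StrictMono l ∧ ∀ k, l k ∈ Set.Ioo u v := by
  have : Nontrivial (Set.Ioo u v) := by
    obtain ⟨x, hx⟩ := exists_between h
    obtain ⟨y, hy⟩ := exists_between hx.1
    exact ⟨⟨⟨x, hx⟩, ⟨y, hy.1, hy.2.trans hx.2⟩, fun e => hy.2.ne' (congrArg Subtype.val e)⟩⟩
  obtain ⟨f⟩ := Order.embedding_from_countable_to_dense ℕ (Set.Ioo u v)
  exact ⟨fun k => f k, fun i j hij => f.strictMono hij, fun k => (f k).2⟩

/-- Indiscernibility for families indexed by a finite subset of an order. -/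
theorem Indiscernible.typeEq_finset {te : ∀ n : ℕ, (Fin n → S) → (Fin n → S) → Prop} {a : J → S}
    (h : Indiscernible te a) (s : Finset I) {f g : I → J} (hf : StrictMonoOn f s)
    (hg : StrictMonoOn g s) :
    te s.card (fun k => a (f (s.orderEmbOfFin rfl k)))
      (fun k => a (g (s.orderEmbOfFin rfl k))) :=
  h s.card
    (OrderEmbedding.ofStrictMono (fun k => f (s.orderEmbOfFin rfl k)) fun _ _ hij =>
      hf (s.orderEmbOfFin_mem rfl _) (s.orderEmbOfFin_mem rfl _)
        ((s.orderEmbOfFin rfl).strictMono hij))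
    (OrderEmbedding.ofStrictMono (fun k => g (s.orderEmbOfFin rfl k)) fun _ _ hij =>
      hg (s.orderEmbOfFin_mem rfl _) (s.orderEmbOfFin_mem rfl _)
        ((s.orderEmbOfFin rfl).strictMono hij))

theorem concat_comp {S S' I J : Type*} (h : S → S') (f : I → S) (g : J → S) :
    concat (fun i => h (f i)) (fun j => h (g j)) = fun x => h (concat f g x) := by
  funext x
  rcases h : ofLex x with i | j <;> simp [concat, h]

/-- The index set of a sequence with one term inserted at the cut `(C, Cᶜ)`. -/
abbrev FillIndex (C : Set I) : Type _ := C ⊕ₗ (Unit ⊕ₗ (Cᶜ : Set I))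

/-- The sequence `a` with the term `b` inserted at the cut `(C, Cᶜ)`. -/
def fillSeq (a : I → S) (C : Set I) (b : S) : FillIndex C → S :=
  concat (restrictTo a C) (concat (single b) (restrictTo a Cᶜ))

open Classical in
/-- The position of an old index after insertion of a new one. -/
noncomputable def place (C : Set I) (i : I) : FillIndex C :=
  if h : i ∈ C then toLex (Sum.inl ⟨i, h⟩) else toLex (Sum.inr (toLex (Sum.inr ⟨i, h⟩)))

/-- The position of the inserted index. -/
def mid (C : Set I) : FillIndex C := toLex (Sum.inr (toLex (Sum.inl ())))

/-- The old index at a position, or `none` for the inserted one. -/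
def old {C : Set I} (x : FillIndex C) : Option I :=
  Sum.elim (fun i : C => some (i : I)) (fun y : Unit ⊕ₗ (Cᶜ : Set I) =>
    Sum.elim (fun _ => none) (fun i : (Cᶜ : Set I) => some (i : I)) (ofLex y)) (ofLex x)

variable {C : Set I}

theorem fillSeq_eq {S I : Type*} {C : Set I} (a : I → S) (b : S) (x : FillIndex C) :
    fillSeq a C b x = (old x).elim b a := by
  rcases x with i | (_ | i) <;> rfl

@[simp] theorem old_place {I : Type*} {C : Set I} (i : I) : old (place C i) = some i := by
  by_cases h : i ∈ C
  · simp [place, h, old]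
  · simp [place, h, old]

@[simp] theorem old_mid {I : Type*} {C : Set I} : old (mid C) = none := rfl

theorem eq_place_or_eq_mid {I : Type*} {C : Set I} (x : FillIndex C) :
    (∃ i, x = place C i) ∨ x = mid C := by
  rcases x with i | (_ | i)
  · refine Or.inl ⟨i, ?_⟩
    simp only [place, i.2, dif_pos]
    rfl
  · exact Or.inr rfl
  · refine Or.inl ⟨i, ?_⟩
    rw [place, dif_neg i.2]
    rfl

theorem place_lt_mid {i : I} (h : i ∈ C) : place C i < mid C := by
  simp [place, h, mid]

theorem mid_lt_place {i : I} (h : i ∉ C) : mid C < place C i := by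
  simp [place, h, mid]

theorem place_strictMono (hC : IsLowerSet C) : StrictMono (place C) := by
  intro i j hij
  by_cases hj : j ∈ C
  · have hi : i ∈ C := hC hij.le hj
    simp [place, hi, hj, hij]
  · by_cases hi : i ∈ C
    · exact (place_lt_mid hi).trans (mid_lt_place hj)
    · simp [place, hi, hj, hij]

end Orders

/-! ### Types of hyperimaginaries through representatives -/

section Classes

variable (L : FirstOrder.Language.{u, v}) {M : Type w} [L.Structure M] {α : Type w}

/-- The classes modulo `E` of two `n`-tuples of elements of `M^α` have the same type over the empty
set: a version of `HypTypeEq` for representatives. -/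
def ClassTypeEq (E : Setoid (α → M)) (n : ℕ) (x y : Fin n → α → M) : Prop :=
  ∃ σ : M ≃[L] M, ∀ k, E (fun c => σ (x k c)) (y k)

variable {L}

theorem TypeDefinable.iff_aut {E : Setoid (α → M)} (hE : TypeDefinable L E) (σ : M ≃[L] M)
    (x y : α → M) : E (fun c => σ (x c)) (fun c => σ (y c)) ↔ E x y := by
  obtain ⟨p, hp⟩ := hE
  rw [hp, hp]
  refine forall₂_congr fun φ _ => ?_
  rw [← (isFormula_realize φ).iff_aut σ (Sum.elim x y)]
  refine iff_of_eq (congrArg _ ?_)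
  funext z
  rcases z with z | z <;> rfl

theorem hypTypeEq_mk_iff {E : Setoid (α → M)} (hE : TypeDefinable L E) {n : ℕ}
    {x y : Fin n → α → M} :
    HypTypeEq L E n (fun k => Quotient.mk E (x k)) (fun k => Quotient.mk E (y k)) ↔
      ClassTypeEq L E n x y := by
  refine exists_congr fun σ => ⟨fun h k => Quotient.eq.1 (h k _ rfl), fun h k r hr => ?_⟩
  exact Quotient.eq.2 (E.trans' ((hE.iff_aut σ _ _).2 (Quotient.eq.1 hr)) (h k))

variable {I J : Type*} [LinearOrder I] [LinearOrder J]

theorem indiscernible_mk_iff {E : Setoid (α → M)} (hE : TypeDefinable L E) {a : I → α → M} :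
    Indiscernible (HypTypeEq L E) (fun i => Quotient.mk E (a i)) ↔
      Indiscernible (ClassTypeEq L E) a :=
  forall₃_congr fun _ _ _ => hypTypeEq_mk_iff hE

theorem fills_mk_iff {E : Setoid (α → M)} (hE : TypeDefinable L E) {a : I → α → M} {C : Set I}
    {b : α → M} :
    Fills (HypTypeEq L E) (fun i => Quotient.mk E (a i)) C (Quotient.mk E b) ↔
      Indiscernible (ClassTypeEq L E) (fillSeq a C b) := by
  rw [← indiscernible_mk_iff hE]
  unfold Fills fillSeq
  rw [← concat_comp (Quotient.mk E), ← concat_comp (Quotient.mk E)]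
  rfl

theorem IsMonster.exists_aut {κ : Cardinal.{w}} (hM : IsMonster L M κ) (hα : #α < κ) {n : ℕ}
    {x y : Fin n → α → M} (h : TupleTypeEq L n x y) :
    ∃ σ : M ≃[L] M, ∀ k c, σ (x k c) = y k c := by
  have hc : #(Fin n × α) < κ := by
    rw [mk_prod]
    refine mul_lt_of_lt hM.aleph0_lt.le ?_ (by simpa using hα)
    simpa using natCast_lt_aleph0.trans hM.aleph0_lt
  obtain ⟨σ, hσ⟩ := hM.homogeneous.exists_aut hc (fun q => x q.1 q.2) (fun q => y q.1 q.2) h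
  exact ⟨σ, fun k c => hσ (k, c)⟩

/-- A sequence of tuples that represents, modulo `E`, an indiscernible sequence of tuples represents
an indiscernible sequence of hyperimaginaries. -/
theorem Indiscernible.classTypeEq {κ : Cardinal.{w}} (hM : IsMonster L M κ) (hα : #α < κ)
    {E : Setoid (α → M)} (hE : TypeDefinable L E) {a a' : I → α → M}
    (ha : Indiscernible (TupleTypeEq L) a) (h : ∀ i, E (a i) (a' i)) :
    Indiscernible (ClassTypeEq L E) a' := by
  intro n i j
  obtain ⟨σ, hσ⟩ := hM.exists_aut hα (ha n i j)
  refine ⟨σ, fun k => ?_⟩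
  have h1 := (hE.iff_aut σ _ _).2 (h (i k))
  have h2 : (fun c => σ (a (i k) c)) = a (j k) := funext fun c => hσ k c
  rw [h2] at h1
  exact E.trans' (E.symm' h1) (h (j k))

theorem Indiscernible.exists_aut_finset {E : Setoid (α → M)} {a : J → α → M}
    (ha : Indiscernible (ClassTypeEq L E) a) (s : Finset I) {f g : I → J}
    (hf : StrictMonoOn f s) (hg : StrictMonoOn g s) :
    ∃ σ : M ≃[L] M, ∀ x ∈ s, E (fun c => σ (a (f x) c)) (a (g x)) := by
  obtain ⟨σ, hσ⟩ := ha.typeEq_finset s hf hg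
  refine ⟨σ, fun x hx => ?_⟩
  obtain ⟨k, rfl⟩ : ∃ k, s.orderEmbOfFin rfl k = x := by
    have := Finset.range_orderEmbOfFin s rfl
    exact (Set.ext_iff.1 this x).2 hx
  exact hσ k

/-- If `b` fills the cut `(C, Cᶜ)` of `a` modulo `E`, then a finite part of `a` can be moved so that
its element with index `p` goes to `b`. -/
theorem exists_aut_fillSeq {E : Setoid (α → M)} {a : I → α → M} {C : Set I} (hC : IsLowerSet C)
    {b : α → M} (hb : Indiscernible (ClassTypeEq L E) (fillSeq a C b)) (s : Finset I) {f : I → I}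
    (hf : StrictMonoOn f s) {p : I} (hp : p ∉ s) (hl : ∀ x ∈ s, x < p → f x ∈ C)
    (hr : ∀ x ∈ s, p < x → f x ∉ C) :
    ∃ σ : M ≃[L] M, (∀ x ∈ s, E (fun c => σ (a x c)) (a (f x))) ∧ E (fun c => σ (a p c)) b := by
  classical
  obtain ⟨σ, hσ⟩ := hb.exists_aut_finset (insert p s) (f := place C)
    (g := fun x => if x = p then mid C else place C (f x))
    ((place_strictMono hC).strictMonoOn _) (by
      intro x hx y hy hxy
      simp only [Finset.coe_insert, Set.mem_insert_iff, Finset.mem_coe] at hx hy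
      rcases hx with rfl | hx
      · rcases hy with rfl | hy
        · exact absurd hxy (lt_irrefl _)
        · simp only [if_true, if_neg hxy.ne']
          exact mid_lt_place (hr y hy hxy)
      · rcases hy with rfl | hy
        · simp only [if_true, if_neg hxy.ne]
          exact place_lt_mid (hl x hx hxy)
        · have hxp : x ≠ p := by rintro rfl; exact hp hx
          have hyp : y ≠ p := by rintro rfl; exact hp hy
          simp only [if_neg hxp, if_neg hyp]
          exact place_strictMono hC (hf hx hy hxy))
  refine ⟨σ, fun x hx => ?_, ?_⟩
  · have := hσ x (Finset.mem_insert_of_mem hx)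
    have hxp : x ≠ p := by rintro rfl; exact hp hx
    simp only [if_neg hxp] at this
    simpa only [fillSeq_eq, old_place, Option.elim] using this
  · have := hσ p (Finset.mem_insert_self _ _)
    simp only [if_true] at this
    simpa only [fillSeq_eq, old_place, old_mid, Option.elim] using this

end Classes

/-! ### NIP and alternation -/

section NIP

variable {L : FirstOrder.Language.{u, v}} {M : Type w} [L.Structure M]

/-- A finite part of a family of variables, renamed by an initial segment of `ℕ`. The empty type
`Fin 0` is needed when `δ` is empty. -/
theorem exists_fin_retraction {δ : Type*} (V : Finset δ) :
    ∃ (m : ℕ) (i : Fin m → δ) (r : δ → Fin m), ∀ z ∈ V, i (r z) = z := by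
  classical
  rcases isEmpty_or_nonempty δ with h | ⟨⟨z₀⟩⟩
  · exact ⟨0, Fin.elim0, h.elim, fun z => h.elim z⟩
  · let e := (insert z₀ V).equivFin
    refine ⟨_, fun k => e.symm k, fun z => if h : z ∈ insert z₀ V then e ⟨z, h⟩
      else e ⟨z₀, Finset.mem_insert_self _ _⟩, fun z hz => ?_⟩
    simp [hz]

/-- NIP for formulas in arbitrary families of variables. -/
theorem HasNIP.exists_bound (h : HasNIP L M) {γ α : Type*} {P : (γ ⊕ α → M) → Prop}
    (hP : IsFormula L P) :
    ∃ n : ℕ, ¬ ∃ (b : Fin n → α → M) (c : Set (Fin n) → γ → M),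
      ∀ (s : Set (Fin n)) (i : Fin n), P (Sum.elim (c s) (b i)) ↔ i ∈ s := by
  obtain ⟨V, hV⟩ := hP.exists_support
  obtain ⟨φ, hφ⟩ := hP
  obtain ⟨k, i₁, r₁, h₁⟩ := exists_fin_retraction V.toLeft
  obtain ⟨l, i₂, r₂, h₂⟩ := exists_fin_retraction V.toRight
  obtain ⟨n, hn⟩ := h k l (φ.relabel (Sum.map r₁ r₂))
  refine ⟨n, fun ⟨b, c, hbc⟩ => hn ⟨fun i => b i ∘ i₂, fun s => c s ∘ i₁, fun s i => ?_⟩⟩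
  rw [FirstOrder.Language.Formula.realize_relabel, hφ, ← hbc s i]
  refine hV _ _ ?_
  rintro (z | z) hz
  · simp [h₁ z (by simpa using hz)]
  · simp [h₂ z (by simpa using hz)]

/-- In an NIP theory a formula does not alternate often on an indiscernible sequence. The sequence
considered is the image of a subsequence of `a` under an automorphism `τ`. -/
theorem HasNIP.exists_alternation_bound {κ : Cardinal.{w}} (hM : IsMonster L M κ)
    (hNIP : HasNIP L M) {γ : Type*} {α : Type w} (hα : #α < κ) {P : (γ ⊕ α → M) → Prop}
    (hP : IsFormula L P) :
    ∃ n : ℕ, ∀ (I : Type w) [LinearOrder I] (a : I → α → M), Indiscernible (TupleTypeEq L) a →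
      ∀ (l : ℕ → I), StrictMono l → ∀ (τ : M ≃[L] M) (c : γ → M),
        (∀ j < n, P (Sum.elim c (fun z => τ (a (l (2 * j)) z)))) →
        ¬ ∀ j < n, ¬ P (Sum.elim c (fun z => τ (a (l (2 * j + 1)) z))) := by
  classical
  obtain ⟨n, hn⟩ := hNIP.exists_bound hP
  refine ⟨n, fun I _ a ha l hl τ c h0 h1 => hn ?_⟩
  -- An automorphism moves the subsequence with pattern `s` to a fixed one, `l 0, …, l (n - 1)`; the
  -- image of the parameters then cuts out `s`.
  let f : Set (Fin n) → Fin n → ℕ := fun s j => if j ∈ s then 2 * j else 2 * j + 1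
  have hf : ∀ s, StrictMono (f s) := by
    intro s i j hij
    have : (i : ℕ) < j := hij
    simp only [f]
    split_ifs <;> omega
  have key : ∀ s, ∃ ρ : M ≃[L] M, ∀ (k : Fin n) z, ρ (a (l (f s k)) z) = a (l k) z := fun s =>
    hM.exists_aut hα (ha n (OrderEmbedding.ofStrictMono (fun k => l (f s k)) (hl.comp (hf s)))
      (OrderEmbedding.ofStrictMono (fun k : Fin n => l k) (hl.comp Fin.val_strictMono)))
  choose ρ hρ using key
  refine ⟨fun i => a (l i), fun s z => ρ s (τ.symm (c z)), fun s i => ?_⟩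
  have e : Sum.elim (fun z => ρ s (τ.symm (c z))) (a (l i)) = fun z =>
      ((ρ s).comp τ.symm) (Sum.elim c (fun z => τ (a (l (f s i)) z)) z) := by
    funext z
    rcases z with z | z
    · simp
    · simp [hρ s i z]
  rw [e, hP.iff_aut]
  by_cases hi : i ∈ s
  · simp only [f, hi, if_true, iff_true]
    exact h0 i i.2
  · simp only [f, hi, if_false, iff_false]
    exact h1 i i.2

end NIP

/-! ### Strong base change for two cuts -/

section BaseChange

set_option maxHeartbeats 2000000 in
/-- An order preserving map `f` on a finite part `S` of the index set for which the indices
`l₁ k₁` and `l₂ k₂` fall into the cuts `C` and `D`: the indices in `S` on either side of `l₁ k₁`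
are sent to the same side of `C`, and likewise for `l₂ k₂` and `D`. The indices in `s`, which lie
away from the cuts, are fixed. -/
theorem exists_shift {I : Type*} [LinearOrder I] {C D : Set I} (hC : IsLowerSet C)
    (hD : IsLowerSet D)
    {u₁ w₁ x₁ v₁ u₂ w₂ x₂ v₂ : I} (hw₁ : w₁ ∈ C) (hx₁ : x₁ ∉ C) (huv : v₁ ≤ u₂)
    (hw₂ : w₂ ∈ D) (hx₂ : x₂ ∉ D) {l₁ m₁ l₂ m₂ : ℕ → I}
    (hl₁ : StrictMono l₁) (hl₁' : ∀ k, l₁ k ∈ Set.Ioo u₁ w₁)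
    (hm₁ : StrictMono m₁) (hm₁' : ∀ k, m₁ k ∈ Set.Ioo x₁ v₁)
    (hl₂ : StrictMono l₂) (hl₂' : ∀ k, l₂ k ∈ Set.Ioo u₂ w₂)
    (hm₂ : StrictMono m₂) (hm₂' : ∀ k, m₂ k ∈ Set.Ioo x₂ v₂)
    (s : Set I) (hs : ∀ x ∈ s, x ∉ Set.Ioo u₁ v₁ ∧ x ∉ Set.Ioo u₂ v₂) (k₁ k₂ : ℕ) (S : Set I)
    (hS : ∀ x ∈ S, x ∈ s ∨ (∃ k, k ≠ k₁ ∧ x = l₁ k) ∨ ∃ k, k ≠ k₂ ∧ x = l₂ k) :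
    ∃ f : I → I, StrictMonoOn f S ∧ (∀ x ∈ s, f x = x) ∧
      (∀ x ∈ S, x < l₁ k₁ → f x ∈ C) ∧ (∀ x ∈ S, l₁ k₁ < x → f x ∉ C) ∧
      (∀ x ∈ S, x < l₂ k₂ → f x ∈ D) ∧ (∀ x ∈ S, l₂ k₂ < x → f x ∉ D) := by
  classical
  have hwx₁ : w₁ < x₁ := lt_of_not_ge fun h => hx₁ (hC h hw₁)
  have hwx₂ : w₂ < x₂ := lt_of_not_ge fun h => hx₂ (hD h hw₂)
  have hP := hl₁' k₁
  have hQ := hl₂' k₂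
  have hxv₁ : x₁ < v₁ := (hm₁' 0).1.trans (hm₁' 0).2
  have hxv₂ : x₂ < v₂ := (hm₂' 0).1.trans (hm₂' 0).2
  have hinv₁ := Function.leftInverse_invFun hl₁.injective
  have hinv₂ := Function.leftInverse_invFun hl₂.injective
  let f : I → I := fun x =>
    if l₁ k₁ < x ∧ x < w₁ then m₁ (Function.invFun l₁ x)
    else if l₂ k₂ < x ∧ x < w₂ then m₂ (Function.invFun l₂ x) else x
  have hfs : ∀ x ∈ s, f x = x ∧ (x ≤ u₁ ∨ v₁ ≤ x) ∧ (x ≤ u₂ ∨ v₂ ≤ x) := by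
    intro x hx
    obtain ⟨h1, h2⟩ := hs x hx
    have h1' : x ≤ u₁ ∨ v₁ ≤ x := by
      by_contra! h
      exact h1 h
    have h2' : x ≤ u₂ ∨ v₂ ≤ x := by
      by_contra! h
      exact h2 h
    refine ⟨?_, h1', h2'⟩
    have n1 : ¬ (l₁ k₁ < x ∧ x < w₁) := by
      rintro ⟨h, h'⟩
      rcases h1' with h1' | h1'
      · exact absurd (hP.1.trans h) h1'.not_gt
      · exact absurd (h'.trans (hwx₁.trans hxv₁)) h1'.not_gt
    have n2 : ¬ (l₂ k₂ < x ∧ x < w₂) := by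
      rintro ⟨h, h'⟩
      rcases h2' with h2' | h2'
      · exact absurd (hQ.1.trans h) h2'.not_gt
      · exact absurd (h'.trans (hwx₂.trans hxv₂)) h2'.not_gt
    simp only [f, if_neg n1, if_neg n2]
  -- `f` is the identity on three of five regions and moves the other two to the right of the cuts.
  have cases : ∀ x ∈ S, (f x = x ∧ x < l₁ k₁) ∨
      (l₁ k₁ < x ∧ x < w₁ ∧ x₁ < f x ∧ f x < v₁ ∧ ∃ k, x = l₁ k ∧ f x = m₁ k) ∨
      (f x = x ∧ v₁ ≤ x ∧ x < l₂ k₂) ∨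
      (l₂ k₂ < x ∧ x < w₂ ∧ x₂ < f x ∧ f x < v₂ ∧ ∃ k, x = l₂ k ∧ f x = m₂ k) ∨
      (f x = x ∧ v₂ ≤ x) := by
    intro x hx
    rcases hS x hx with h | ⟨k, hk, rfl⟩ | ⟨k, hk, rfl⟩
    · obtain ⟨h, h1 | h1, h2 | h2⟩ := hfs x h
      · exact Or.inl ⟨h, h1.trans_lt hP.1⟩
      · exact Or.inl ⟨h, h1.trans_lt hP.1⟩
      · exact Or.inr (Or.inr (Or.inl ⟨h, h1, h2.trans_lt hQ.1⟩))
      · exact Or.inr (Or.inr (Or.inr (Or.inr ⟨h, h2⟩)))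
    · rcases lt_or_gt_of_ne hk with hk | hk
      · refine Or.inl ⟨?_, hl₁ hk⟩
        have n1 : ¬ (l₁ k₁ < l₁ k ∧ l₁ k < w₁) := fun h => absurd (hl₁ hk) h.1.not_gt
        have n2 : ¬ (l₂ k₂ < l₁ k ∧ l₁ k < w₂) := fun h => by
          have h1 := (hl₁' k).2
          have h2 := hQ.1
          have h3 := h.1
          order
        simp only [f, if_neg n1, if_neg n2]
      · have e : f (l₁ k) = m₁ k := by
          have p1 : l₁ k₁ < l₁ k ∧ l₁ k < w₁ := ⟨hl₁ hk, (hl₁' k).2⟩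
          simp only [f, if_pos p1, hinv₁ k]
        exact Or.inr (Or.inl ⟨hl₁ hk, (hl₁' k).2, e ▸ (hm₁' k).1, e ▸ (hm₁' k).2, k, rfl, e⟩)
    · have n1 : ¬ (l₁ k₁ < l₂ k ∧ l₂ k < w₁) := fun h => by
        have h1 := (hl₂' k).1
        have h2 := h.2
        order
      rcases lt_or_gt_of_ne hk with hk | hk
      · refine Or.inr (Or.inr (Or.inl ⟨?_, (huv.trans_lt (hl₂' k).1).le, hl₂ hk⟩))
        have n2 : ¬ (l₂ k₂ < l₂ k ∧ l₂ k < w₂) := fun h => absurd (hl₂ hk) h.1.not_gt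
        simp only [f, if_neg n1, if_neg n2]
      · have e : f (l₂ k) = m₂ k := by
          have p2 : l₂ k₂ < l₂ k ∧ l₂ k < w₂ := ⟨hl₂ hk, (hl₂' k).2⟩
          simp only [f, if_neg n1, if_pos p2, hinv₂ k]
        exact Or.inr (Or.inr (Or.inr (Or.inl
          ⟨hl₂ hk, (hl₂' k).2, e ▸ (hm₂' k).1, e ▸ (hm₂' k).2, k, rfl, e⟩)))
  have hP1 := hP.1
  have hP2 := hP.2
  have hQ1 := hQ.1
  have hQ2 := hQ.2
  have hfix : ∀ x ∈ s, f x = x := fun x hx => (hfs x hx).1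
  clear hfs hS hs hinv₁ hinv₂ hl₁' hl₂' hm₁' hm₂' hP hQ
  clear_value f
  refine ⟨f, ?_, hfix, ?_, ?_, ?_, ?_⟩
  · intro x hx y hy hxy
    rcases cases x hx with ⟨ex, h1⟩ | ⟨h1, h2, h3, h4, k, rfl, ek⟩ | ⟨ex, h1, h2⟩ |
        ⟨h1, h2, h3, h4, k, rfl, ek⟩ | ⟨ex, h1⟩ <;>
      rcases cases y hy with ⟨ey, g1⟩ | ⟨g1, g2, g3, g4, j, rfl, ej⟩ | ⟨ey, g1, g2⟩ |
        ⟨g1, g2, g3, g4, j, rfl, ej⟩ | ⟨ey, g1⟩ <;>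
      first
      | order
      | (rw [ek, ej]; exact hm₁ (hl₁.lt_iff_lt.1 hxy))
      | (rw [ek, ej]; exact hm₂ (hl₂.lt_iff_lt.1 hxy))
  · intro x hx h
    refine hC (a := w₁) ?_ hw₁
    rcases cases x hx with ⟨ex, h1⟩ | ⟨h1, h2, h3, h4, -⟩ | ⟨ex, h1, h2⟩ |
        ⟨h1, h2, h3, h4, -⟩ | ⟨ex, h1⟩ <;> order
  · intro x hx h hf
    refine hx₁ (hC (a := f x) ?_ hf)
    rcases cases x hx with ⟨ex, h1⟩ | ⟨h1, h2, h3, h4, -⟩ | ⟨ex, h1, h2⟩ |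
        ⟨h1, h2, h3, h4, -⟩ | ⟨ex, h1⟩ <;> order
  · intro x hx h
    refine hD (a := w₂) ?_ hw₂
    rcases cases x hx with ⟨ex, h1⟩ | ⟨h1, h2, h3, h4, -⟩ | ⟨ex, h1, h2⟩ |
        ⟨h1, h2, h3, h4, -⟩ | ⟨ex, h1⟩ <;> order
  · intro x hx h hf
    refine hx₂ (hD (a := f x) ?_ hf)
    rcases cases x hx with ⟨ex, h1⟩ | ⟨h1, h2, h3, h4, -⟩ | ⟨ex, h1, h2⟩ |
        ⟨h1, h2, h3, h4, -⟩ | ⟨ex, h1⟩ <;> order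

variable {L : FirstOrder.Language.{u, v}} {M : Type w} [L.Structure M]

/-- Strong base change for two cuts. Let `P₁`, `P₂` be formulas with parameters that hold for all
representatives of the terms of `a` near the cuts `C` and `D`. Then the fillers `b`, `d` modulo `E`
have conjugates over finitely many given terms modulo `E`, with representatives that satisfy `P₁`
and `P₂`.

If this fails, some conjugate of `b` all of whose representatives violate `P₁`, or of `d` all of
whose representatives violate `P₂`, can be inserted into the sequence modulo `E`, which is still
indiscernible. This is repeated with the new sequence. One of the two alternatives occurs often, and
gives many alternations of a formula. -/
theorem exists_base_change {κ : Cardinal.{w}} (hM : IsMonster L M κ) (hNIP : HasNIP L M)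
    {α : Type w} (hα : #α < κ) {E : Setoid (α → M)} (hE : TypeDefinable L E)
    {I : Type w} [LinearOrder I] [DenselyOrdered I] {a : I → α → M}
    (ha : Indiscernible (TupleTypeEq L) a) {C D : Set I} (hC : IsLowerSet C) (hD : IsLowerSet D)
    {b d : α → M} (hb : Indiscernible (ClassTypeEq L E) (fillSeq a C b))
    (hd : Indiscernible (ClassTypeEq L E) (fillSeq a D d))
    {u₁ w₁ x₁ v₁ u₂ w₂ x₂ v₂ : I} (huw₁ : u₁ < w₁) (hw₁ : w₁ ∈ C) (hx₁ : x₁ ∉ C)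
    (hxv₁ : x₁ < v₁) (huv : v₁ ≤ u₂) (huw₂ : u₂ < w₂) (hw₂ : w₂ ∈ D) (hx₂ : x₂ ∉ D)
    (hxv₂ : x₂ < v₂) {γ : Type*} {P₁ P₂ : (γ ⊕ α → M) → Prop} (hP₁ : IsFormula L P₁)
    (hP₂ : IsFormula L P₂) {c : γ → M}
    (h₁ : ∀ i ∈ Set.Ioo u₁ v₁, ∀ z, E z (a i) → P₁ (Sum.elim c z))
    (h₂ : ∀ i ∈ Set.Ioo u₂ v₂, ∀ z, E z (a i) → P₂ (Sum.elim c z))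
    (s : Finset I) (hs : ∀ x ∈ s, x ∉ Set.Ioo u₁ v₁ ∧ x ∉ Set.Ioo u₂ v₂) :
    ∃ (σ : M ≃[L] M) (y z : α → M), (∀ x ∈ s, E (fun t => σ (a x t)) (a x)) ∧
      E y (fun t => σ (b t)) ∧ E z (fun t => σ (d t)) ∧
      P₁ (Sum.elim c y) ∧ P₂ (Sum.elim c z) := by
  classical
  have hwx₁ : w₁ < x₁ := lt_of_not_ge fun h => hx₁ (hC h hw₁)
  have hwx₂ : w₂ < x₂ := lt_of_not_ge fun h => hx₂ (hD h hw₂)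
  obtain ⟨n₁, hn₁⟩ := hNIP.exists_alternation_bound hM hα hP₁
  obtain ⟨n₂, hn₂⟩ := hNIP.exists_alternation_bound hM hα hP₂
  obtain ⟨l₁, hl₁, hl₁'⟩ := exists_strictMono_mem_Ioo huw₁
  obtain ⟨m₁, hm₁, hm₁'⟩ := exists_strictMono_mem_Ioo hxv₁
  obtain ⟨l₂, hl₂, hl₂'⟩ := exists_strictMono_mem_Ioo huw₂
  obtain ⟨m₂, hm₂, hm₂'⟩ := exists_strictMono_mem_Ioo hxv₂
  have he : Indiscernible (ClassTypeEq L E) a := ha.classTypeEq hM hα hE fun _ => E.refl' _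
  by_contra hno
  let T : Finset I := s ∪ (Finset.range n₁).image (fun j => l₁ (2 * j)) ∪
    (Finset.range n₂).image (fun j => l₂ (2 * j))
  -- In state `St p q` the sequence modulo `E` given by `τ` has its terms in `T` unchanged, with `p`
  -- violations of `P₁` inserted between the `l₁ (2 * j)`, and `q` of `P₂` between the `l₂ (2 * j)`.
  let St : ℕ → ℕ → Prop := fun p q => ∃ τ : M ≃[L] M,
    (∀ x ∈ T, E (fun t => τ (a x t)) (a x)) ∧
    (∀ j < p, ∀ z, E z (fun t => τ (a (l₁ (2 * j + 1)) t)) → ¬ P₁ (Sum.elim c z)) ∧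
    (∀ j < q, ∀ z, E z (fun t => τ (a (l₂ (2 * j + 1)) t)) → ¬ P₂ (Sum.elim c z))
  have step : ∀ p q, St p q → St (p + 1) q ∨ St p (q + 1) := by
    rintro p q ⟨τ, hτT, hτ₁, hτ₂⟩
    let S : Finset I := T ∪ (Finset.range p).image (fun j => l₁ (2 * j + 1)) ∪
      (Finset.range q).image (fun j => l₂ (2 * j + 1))
    have hTS : ∀ x ∈ T, x ∈ S := fun x hx => by simp only [S, Finset.mem_union]; simp [hx]
    have hS₁ : ∀ j < p, l₁ (2 * j + 1) ∈ S := fun j hj => by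
      simp only [S, Finset.mem_union, Finset.mem_image, Finset.mem_range]
      exact Or.inl (Or.inr ⟨j, hj, rfl⟩)
    have hS₂ : ∀ j < q, l₂ (2 * j + 1) ∈ S := fun j hj => by
      simp only [S, Finset.mem_union, Finset.mem_image, Finset.mem_range]
      exact Or.inr ⟨j, hj, rfl⟩
    have hsT : ∀ x ∈ s, x ∈ T := fun x hx => by simp only [T, Finset.mem_union]; simp [hx]
    have hS : ∀ x ∈ (S : Set I), x ∈ (s : Set I) ∨ (∃ k, k ≠ 2 * p + 1 ∧ x = l₁ k) ∨
        ∃ k, k ≠ 2 * q + 1 ∧ x = l₂ k := by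
      intro x hx
      simp only [S, T, Finset.coe_union, Set.mem_union, Finset.mem_coe, Finset.mem_image,
        Finset.mem_range] at hx
      rcases hx with (((hx | ⟨j, hj, rfl⟩) | ⟨j, hj, rfl⟩) | ⟨j, hj, rfl⟩) | ⟨j, hj, rfl⟩
      · exact Or.inl hx
      · exact Or.inr (Or.inl ⟨_, by omega, rfl⟩)
      · exact Or.inr (Or.inr ⟨_, by omega, rfl⟩)
      · exact Or.inr (Or.inl ⟨_, by omega, rfl⟩)
      · exact Or.inr (Or.inr ⟨_, by omega, rfl⟩)
    obtain ⟨f, hf, hfs, hfC, hfC', hfD, hfD'⟩ := exists_shift hC hD hw₁ hx₁ huv hw₂ hx₂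
      hl₁ hl₁' hm₁ hm₁' hl₂ hl₂' hm₂ hm₂' (s : Set I) hs (2 * p + 1) (2 * q + 1) (S : Set I) hS
    have hdisj : ∀ i j, l₁ i ≠ l₂ j := fun i j => ne_of_lt <|
      (hl₁' i).2.trans (hwx₁.trans (hxv₁.trans_le (huv.trans (hl₂' j).1.le)))
    have hpS : l₁ (2 * p + 1) ∉ S := by
      intro h
      rcases hS _ h with h | ⟨k, hk, h⟩ | ⟨k, hk, h⟩
      · exact (hs _ h).1 ⟨(hl₁' _).1, (hl₁' _).2.trans (hwx₁.trans hxv₁)⟩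
      · exact hk (hl₁.injective h).symm
      · exact hdisj _ _ h
    have hqS : l₂ (2 * q + 1) ∉ S := by
      intro h
      rcases hS _ h with h | ⟨k, hk, h⟩ | ⟨k, hk, h⟩
      · exact (hs _ h).2 ⟨(hl₂' _).1, (hl₂' _).2.trans (hwx₂.trans hxv₂)⟩
      · exact hdisj _ _ h.symm
      · exact hk (hl₂.injective h).symm
    obtain ⟨ρ, hρ⟩ := he.exists_aut_finset S hf (strictMonoOn_id)
    have hσ : ∀ x ∈ S, E (fun t => τ (ρ (a (f x) t))) (fun t => τ (a x t)) := fun x hx =>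
      (hE.iff_aut τ _ _).2 (hρ x hx)
    have hσs : ∀ x ∈ s, E (fun t => τ (ρ (a x t))) (a x) := fun x hx => by
      have h := hσ x (hTS x (hsT x hx))
      rw [hfs x hx] at h
      exact E.trans' h (hτT x (hsT x hx))
    -- `τ ∘ ρ` takes `b` and `d` to fillers of the cuts of the current sequence at the free indices
    -- `l₁ (2 * p + 1)` and `l₂ (2 * q + 1)`.
    have hfail : (∀ y, E y (fun t => τ (ρ (b t))) → ¬ P₁ (Sum.elim c y)) ∨
        ∀ z, E z (fun t => τ (ρ (d t))) → ¬ P₂ (Sum.elim c z) := by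
      by_contra! h
      obtain ⟨⟨y, hy, hyP⟩, z, hz, hzP⟩ := h
      exact hno ⟨τ.comp ρ, y, z, hσs, hy, hz, hyP, hzP⟩
    rcases hfail with hfail | hfail
    · obtain ⟨π, hπ, hπp⟩ := exists_aut_fillSeq hC hb S hf hpS hfC hfC'
      have hτ' : ∀ x ∈ S, E (fun t => τ (ρ (π (a x t)))) (fun t => τ (a x t)) := fun x hx =>
        E.trans' ((hE.iff_aut (τ.comp ρ) _ _).2 (hπ x hx)) (hσ x hx)
      refine Or.inl ⟨(τ.comp ρ).comp π, fun x hx => E.trans' (hτ' x (hTS x hx)) (hτT x hx),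
        fun j hj z hz => ?_, fun j hj z hz => hτ₂ j hj z (E.trans' hz (hτ' _ (hS₂ j hj)))⟩
      rcases Nat.lt_succ_iff_lt_or_eq.1 hj with hj | rfl
      · exact hτ₁ j hj z (E.trans' hz (hτ' _ (hS₁ j hj)))
      · exact hfail z (E.trans' hz ((hE.iff_aut (τ.comp ρ) _ _).2 hπp))
    · obtain ⟨π, hπ, hπq⟩ := exists_aut_fillSeq hD hd S hf hqS hfD hfD'
      have hτ' : ∀ x ∈ S, E (fun t => τ (ρ (π (a x t)))) (fun t => τ (a x t)) := fun x hx =>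
        E.trans' ((hE.iff_aut (τ.comp ρ) _ _).2 (hπ x hx)) (hσ x hx)
      refine Or.inr ⟨(τ.comp ρ).comp π, fun x hx => E.trans' (hτ' x (hTS x hx)) (hτT x hx),
        fun j hj z hz => hτ₁ j hj z (E.trans' hz (hτ' _ (hS₁ j hj))), fun j hj z hz => ?_⟩
      rcases Nat.lt_succ_iff_lt_or_eq.1 hj with hj | rfl
      · exact hτ₂ j hj z (E.trans' hz (hτ' _ (hS₂ j hj)))
      · exact hfail z (E.trans' hz ((hE.iff_aut (τ.comp ρ) _ _).2 hπq))
  have all : ∀ m, ∃ p q, p + q = m ∧ St p q := by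
    intro m
    induction m with
    | zero =>
      exact ⟨0, 0, rfl, FirstOrder.Language.Equiv.refl L M, fun x _ => E.refl' _,
        fun j hj => absurd hj (Nat.not_lt_zero j), fun j hj => absurd hj (Nat.not_lt_zero j)⟩
    | succ m ih =>
      obtain ⟨p, q, hpq, h⟩ := ih
      rcases step p q h with h | h
      · exact ⟨_, _, by omega, h⟩
      · exact ⟨_, _, by omega, h⟩
  obtain ⟨p, q, hpq, τ, hτT, hτ₁, hτ₂⟩ := all (n₁ + n₂)
  rcases (by omega : n₁ ≤ p ∨ n₂ ≤ q) with h | h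
  · refine hn₁ I a ha l₁ hl₁ τ c (fun j hj => ?_) fun j hj => hτ₁ j (by omega) _ (E.refl' _)
    refine h₁ (l₁ (2 * j)) ⟨(hl₁' _).1, (hl₁' _).2.trans (hwx₁.trans hxv₁)⟩ _ (hτT _ ?_)
    simp only [T, Finset.mem_union, Finset.mem_image, Finset.mem_range]
    exact Or.inl (Or.inr ⟨j, hj, rfl⟩)
  · refine hn₂ I a ha l₂ hl₂ τ c (fun j hj => ?_) fun j hj => hτ₂ j (by omega) _ (E.refl' _)
    refine h₂ (l₂ (2 * j)) ⟨(hl₂' _).1, (hl₂' _).2.trans (hwx₂.trans hxv₂)⟩ _ (hτT _ ?_)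
    simp only [T, Finset.mem_union, Finset.mem_image, Finset.mem_range]
    exact Or.inr ⟨j, hj, rfl⟩

end BaseChange

/-! ### Lifting two fillers to one sequence of representatives -/

section CommonLift

variable (L : FirstOrder.Language.{u, v}) {M : Type w} [L.Structure M]

/-- An instance of the condition that a sequence, given by its old terms and one term inserted at
the cut `(C, Cᶜ)`, has the same finite increasing subsequences, up to type, as a given sequence:
two increasing tuples of indices, and a formula. -/
def FillCond {I : Type*} [LinearOrder I] (C : Set I) (α : Type*) : Type _ :=
  Σ n : ℕ, (Fin n ↪o FillIndex C) × (Fin n ↪o I) × L.Formula (Fin n × α)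

variable {L}
variable {I : Type*} [LinearOrder I] {C : Set I} {α : Type w}

/-- The condition `k` holds for the sequence with old terms `x (some i)` and inserted term
`x none`. -/
def FillCond.Holds (k : FillCond L C α) (a : I → α → M) (x : Option I → α → M) : Prop :=
  k.2.2.2.Realize (fun q => x (old (k.2.1 q.1)) q.2) ↔
    k.2.2.2.Realize (fun q => a (k.2.2.1 q.1) q.2)

/-- The old indices that occur in a condition. -/
def FillCond.support (k : FillCond L C α) : Finset I :=
  Finset.eraseNone (Finset.univ.image fun t => old (k.2.1 t))

theorem FillCond.isFormula (k : FillCond L C α) (a : I → α → M) :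
    IsFormula L (fun v : Option I × α → M => k.Holds a fun o c => v (o, c)) :=
  ((isFormula_realize k.2.2.2).reindex fun q => (old (k.2.1 q.1), q.2)).iff (isFormula_const _)

theorem FillCond.holds_congr (k : FillCond L C α) (a : I → α → M) {x x' : Option I → α → M}
    (h : x none = x' none) (h' : ∀ i ∈ k.support, x (some i) = x' (some i)) :
    k.Holds a x ↔ k.Holds a x' := by
  have e : (fun q : Fin k.1 × α => x (old (k.2.1 q.1)) q.2) =
      fun q => x' (old (k.2.1 q.1)) q.2 := by
    funext q
    rcases ho : old (k.2.1 q.1) with _ | i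
    · rw [h]
    · rw [h' i]
      simp only [support, Finset.mem_eraseNone, Finset.mem_image, Finset.mem_univ, true_and]
      exact ⟨_, ho⟩
  rw [Holds, Holds, e]

theorem FillCond.holds_aut (k : FillCond L C α) (a : I → α → M) (x : Option I → α → M)
    (σ : M ≃[L] M) : k.Holds a (fun o c => σ (x o c)) ↔ k.Holds a x :=
  (k.isFormula a).iff_aut σ (fun q => x q.1 q.2)

/-- A condition holds if the inserted term is a term of the sequence with index `t` in the right
position with respect to the finitely many indices that matter. -/
theorem FillCond.holds_of_index (k : FillCond L C α) (hC : IsLowerSet C) {a : I → α → M}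
    (ha : Indiscernible (TupleTypeEq L) a) {t : I} (ht : ∀ x ∈ k.support, x ∈ C → x < t)
    (ht' : ∀ x ∈ k.support, x ∉ C → t < x) : k.Holds a (fun o => o.elim (a t) a) := by
  have hlt : StrictMono fun s : Fin k.1 => (old (k.2.1 s)).elim t id := by
    intro r s hrs
    have h1 : k.2.1 r < k.2.1 s := k.2.1.strictMono hrs
    have hmem : ∀ (r : Fin k.1) i, k.2.1 r = place C i → i ∈ k.support := by
      intro r i h
      simp only [support, Finset.mem_eraseNone, Finset.mem_image, Finset.mem_univ, true_and]
      exact ⟨r, by rw [h, old_place]⟩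
    rcases eq_place_or_eq_mid (k.2.1 r) with ⟨i, hi⟩ | hi <;>
      rcases eq_place_or_eq_mid (k.2.1 s) with ⟨j, hj⟩ | hj
    · simp only [hi, hj, old_place, Option.elim, id]
      rw [hi, hj] at h1
      exact (place_strictMono hC).lt_iff_lt.1 h1
    · simp only [hi, hj, old_place, old_mid, Option.elim, id]
      refine ht i (hmem r i hi) ?_
      by_contra hiC
      rw [hi, hj] at h1
      exact h1.not_gt (mid_lt_place hiC)
    · simp only [hi, hj, old_place, old_mid, Option.elim, id]
      refine ht' j (hmem s j hj) fun hjC => ?_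
      rw [hi, hj] at h1
      exact h1.not_gt (place_lt_mid hjC)
    · rw [hi, hj] at h1
      exact absurd h1 (lt_irrefl _)
  have := ha k.1 (OrderEmbedding.ofStrictMono _ hlt) k.2.2.1 k.2.2.2
  rw [Holds, ← this]
  refine iff_of_eq (congrArg _ ?_)
  funext q
  rcases h : old (k.2.1 q.1) with _ | i <;> simp [h]

/-- The property of a tuple `z` that `x` satisfies given formulas together with `z`, and given
conditions for filling a cut of `a`, for some `x`. The terms of `a` are variables as well. -/
def NearFill (a : I → α → M) (p : Finset (L.Formula (α ⊕ α))) (G : Finset (FillCond L C α))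
    (v : (I × α) ⊕ α → M) : Prop :=
  ∃ x : α → M, (∀ φ ∈ p, φ.Realize (Sum.elim (fun c => v (Sum.inr c)) x)) ∧
    ∀ k ∈ G, k.Holds a (fun o => o.elim x fun i c => v (Sum.inl (i, c)))

theorem isFormula_nearFill [Nonempty M] (a : I → α → M) (p : Finset (L.Formula (α ⊕ α)))
    (G : Finset (FillCond L C α)) : IsFormula L (NearFill a p G) := by
  let h₁ : α ⊕ α → ((I × α) ⊕ α) ⊕ α := Sum.elim (fun c => Sum.inl (Sum.inr c)) Sum.inr
  let h₂ : Option I × α → ((I × α) ⊕ α) ⊕ α := fun q =>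
    q.1.elim (Sum.inr q.2) fun i => Sum.inl (Sum.inl (i, q.2))
  have H := (IsFormula.and
    (IsFormula.forall_mem (fun φ : L.Formula (α ⊕ α) =>
      (isFormula_realize (M := M) φ).reindex h₁) p)
    (IsFormula.forall_mem (fun k : FillCond L C α => (k.isFormula a).reindex h₂) G)).exists
  obtain ⟨ψ, hψ⟩ := H
  refine ⟨ψ, fun v => (hψ v).trans (exists_congr fun x => and_congr ?_ ?_)⟩
  · refine forall₂_congr fun φ _ => iff_of_eq (congrArg _ ?_)
    funext c
    rcases c with c | c <;> rfl
  · refine forall₂_congr fun k _ => iff_of_eq (congrArg _ ?_)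
    funext o c
    rcases o with _ | i <;> rfl

/-- Used to find an interval around a cut that contains no index in `s`. -/
theorem exists_upper_bound_mem {C : Set I} {c₀ : I} (h : c₀ ∈ C) (s : Finset I) :
    ∃ u ∈ C, c₀ ≤ u ∧ ∀ x ∈ s, x ∈ C → x ≤ u := by
  classical
  have hne : (insert c₀ (s.filter (· ∈ C))).Nonempty := ⟨c₀, Finset.mem_insert_self _ _⟩
  refine ⟨_, ?_, Finset.le_max' (insert c₀ (s.filter (· ∈ C))) _ (Finset.mem_insert_self _ _),
    fun x hx hxC => Finset.le_max' _ _
      (Finset.mem_insert_of_mem (Finset.mem_filter.2 ⟨hx, hxC⟩))⟩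
  rcases Finset.mem_insert.1 (Finset.max'_mem _ hne) with e | e
  · rw [e]
    exact h
  · exact (Finset.mem_filter.1 e).2

theorem exists_lower_bound_mem {C : Set I} {c₀ : I} (h : c₀ ∈ C) (s : Finset I) :
    ∃ u ∈ C, u ≤ c₀ ∧ ∀ x ∈ s, x ∈ C → u ≤ x :=
  exists_upper_bound_mem (I := Iᵒᵈ) h s

/-- Two sequences of tuples whose corresponding finite increasing subsequences have the same type
are conjugate. -/
theorem IsMonster.exists_aut_of_typeEq {κ : Cardinal.{w}} (hM : IsMonster L M κ) (hα : #α < κ)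
    {I : Type w} [LinearOrder I] (hI : #I < κ) {a a' : I → α → M}
    (h : ∀ (n : ℕ) (i : Fin n ↪o I), TupleTypeEq L n (fun k => a (i k)) (fun k => a' (i k))) :
    ∃ ρ : M ≃[L] M, ∀ i c, ρ (a i c) = a' i c := by
  classical
  have hc : #(I × α) < κ := by
    rw [mk_prod, lift_id, lift_id]
    exact mul_lt_of_lt hM.aleph0_lt.le hI hα
  obtain ⟨ρ, hρ⟩ := hM.homogeneous.exists_aut hc (fun q => a q.1 q.2) (fun q => a' q.1 q.2) (by
    intro φ
    obtain ⟨V, hV⟩ := (isFormula_realize (M := M) φ).exists_support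
    obtain ⟨π, hπ⟩ := hM.exists_aut hα (h _ ((V.image Prod.fst).orderEmbOfFin rfl))
    rw [← (isFormula_realize φ).iff_aut π]
    refine hV _ _ fun q hq => ?_
    have hq' : q.1 ∈ V.image Prod.fst := Finset.mem_image_of_mem _ hq
    obtain ⟨k, hk⟩ : ∃ k, (V.image Prod.fst).orderEmbOfFin rfl k = q.1 :=
      (Set.ext_iff.1 (Finset.range_orderEmbOfFin (V.image Prod.fst) rfl) q.1).2 hq'
    simpa only [hk] using hπ k q.2)
  exact ⟨ρ, fun i c => hρ (i, c)⟩

/-- The point of the extended sequence at an old index, or the filler of the left (`false`) or of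
the right (`true`) cut. -/
def point (s : Bool) (o : Option I) : I ⊕ Bool := o.elim (Sum.inr s) Sum.inl

/-- Fillers `b`, `d`, modulo `E`, of two cuts of an indiscernible sequence of tuples `a` lift to
fillers of these cuts in a single sequence `a'` of representatives with the type of `a`. -/
theorem exists_common_lift [Nonempty M] {κ : Cardinal.{w}} (hM : IsMonster L M κ)
    (hNIP : HasNIP L M) (hα : #α < κ) {E : Setoid (α → M)} (hE : TypeDefinable L E)
    {I : Type w} [LinearOrder I] [DenselyOrdered I] (hI : #I < κ) {a : I → α → M}
    (ha : Indiscernible (TupleTypeEq L) a) {C D : Set I} (hC : IsDedekindCut C)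
    (hD : IsDedekindCut D) (hCD : C ⊂ D) {b d : α → M}
    (hb : Indiscernible (ClassTypeEq L E) (fillSeq a C b))
    (hd : Indiscernible (ClassTypeEq L E) (fillSeq a D d)) :
    ∃ (a' : I → α → M) (b' d' : α → M), (∀ i, E (a' i) (a i)) ∧ E b' b ∧ E d' d ∧
      (∀ (n : ℕ) (i : Fin n ↪o FillIndex C) (j : Fin n ↪o I),
        TupleTypeEq L n (fun k => fillSeq a' C b' (i k)) (fun k => a (j k))) ∧
      (∀ (n : ℕ) (i : Fin n ↪o FillIndex D) (j : Fin n ↪o I),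
        TupleTypeEq L n (fun k => fillSeq a' D d' (i k)) (fun k => a (j k))) := by
  classical
  have hE' := hE
  obtain ⟨p, hp⟩ := hE'
  let δ : Type w := (I ⊕ Bool) × Fin 3 × α
  have hδ : #δ < κ := by
    have h0 := hM.aleph0_lt
    simp only [δ, mk_prod, mk_sum, lift_id, lift_uzero, mk_fintype, Fintype.card_bool,
      Fintype.card_fin, lift_natCast]
    exact mul_lt_of_lt h0.le (add_lt_of_lt h0.le hI (natCast_lt_aleph0.trans h0))
      (mul_lt_of_lt h0.le (natCast_lt_aleph0.trans h0) hα)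
  let K := ((I ⊕ Bool) × Bool × p) ⊕ (FillCond L C α ⊕ FillCond L D α)
  let lo : Bool → Fin 3 := fun s => if s then 1 else 0
  let hi : Bool → Fin 3 := fun s => if s then 2 else 1
  -- Level `0` carries the given tuples, level `2` the tuples to be found, and level `1` tuples
  -- equivalent to both.
  let P : K → (δ → M) → Prop := Sum.elim
    (fun k v => k.2.2.1.Realize (fun q => v (k.1, Sum.elim
      (fun c => (lo k.2.1, c)) (fun c => (hi k.2.1, c)) q)))
    (Sum.elim (fun k v => k.Holds a fun o c => v (point false o, 2, c))
      (fun k v => k.Holds a fun o c => v (point true o, 2, c)))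
  have hP : ∀ k, IsFormula L (P k) := by
    rintro (k | k | k)
    · exact (isFormula_realize k.2.2.1).reindex _
    · exact (k.isFormula a).reindex fun q => (point false q.1, 2, q.2)
    · exact (k.isFormula a).reindex fun q => (point true q.1, 2, q.2)
  have hPE : ∀ (w : I ⊕ Bool) (s : Bool) (e : p) (v : δ → M),
      E (fun c => v (w, lo s, c)) (fun c => v (w, hi s, c)) → P (Sum.inl (w, s, e)) v := by
    intro w s e v h
    have := (hp _ _).1 h e.1 e.2
    refine (iff_of_eq (congrArg e.1.Realize ?_)).1 this
    funext q
    rcases q with q | q <;> rfl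
  let f : δ → M := fun q => Sum.elim a (fun s => if s then d else b) q.1 q.2.2
  obtain ⟨v, hvf, hv⟩ := hM.saturated.exists_forall hδ hP {q | q.2.1 = 0} f (by
    intro F
    let G₁ : Finset (FillCond L C α) := F.toRight.toLeft
    let G₂ : Finset (FillCond L D α) := F.toRight.toRight
    let pF : Finset (L.Formula (α ⊕ α)) := F.toLeft.image fun k => k.2.2.1
    let s : Finset I := G₁.biUnion FillCond.support ∪ G₂.biUnion FillCond.support
    obtain ⟨m, hmD, hmC⟩ := Set.exists_of_ssubset hCD
    obtain ⟨c₁, hc₁⟩ := hC.left_nonempty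
    obtain ⟨c₂, hc₂⟩ := hD.right_nonempty
    obtain ⟨u₁, hu₁, -, hsu₁⟩ := exists_upper_bound_mem hc₁ s
    obtain ⟨v₁, hv₁, hv₁m, hsv₁⟩ := exists_lower_bound_mem (C := Cᶜ) hmC s
    obtain ⟨u₂, hu₂, hmu₂, hsu₂⟩ := exists_upper_bound_mem hmD s
    obtain ⟨v₂, hv₂, -, hsv₂⟩ := exists_lower_bound_mem hc₂ s
    obtain ⟨w₁, hw₁, huw₁⟩ := hC.left_no_max u₁ hu₁
    obtain ⟨x₁, hx₁, hxv₁⟩ := hC.right_no_min v₁ hv₁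
    obtain ⟨w₂, hw₂, huw₂⟩ := hD.left_no_max u₂ hu₂
    obtain ⟨x₂, hx₂, hxv₂⟩ := hD.right_no_min v₂ hv₂
    have hE_pF : ∀ x y, E x y → ∀ φ ∈ pF, φ.Realize (Sum.elim x y) := by
      intro x y h φ hφ
      obtain ⟨k, -, rfl⟩ := Finset.mem_image.1 hφ
      exact (hp x y).1 h _ k.2.2.2
    obtain ⟨σ, y, z, hσ, hy, hz, ⟨y', hyy', hy'⟩, z', hzz', hz'⟩ :=
      exists_base_change hM hNIP hα hE ha hC.lower hD.lower hb hd huw₁ hw₁ hx₁ hxv₁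
        (hv₁m.trans hmu₂) huw₂ hw₂ hx₂ hxv₂ (isFormula_nearFill a pF G₁)
        (isFormula_nearFill a pF G₂) (c := fun q => a q.1 q.2)
        (fun i hi x hx => ⟨a i, hE_pF _ _ hx, fun k hk => k.holds_of_index hC.lower ha
          (fun j hj hjC => (hsu₁ j (Finset.mem_union_left _
            (Finset.mem_biUnion.2 ⟨k, hk, hj⟩)) hjC).trans_lt hi.1)
          (fun j hj hjC => hi.2.trans_le (hsv₁ j (Finset.mem_union_left _
            (Finset.mem_biUnion.2 ⟨k, hk, hj⟩)) hjC))⟩)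
        (fun i hi x hx => ⟨a i, hE_pF _ _ hx, fun k hk => k.holds_of_index hD.lower ha
          (fun j hj hjD => (hsu₂ j (Finset.mem_union_right _
            (Finset.mem_biUnion.2 ⟨k, hk, hj⟩)) hjD).trans_lt hi.1)
          (fun j hj hjD => hi.2.trans_le (hsv₂ j (Finset.mem_union_right _
            (Finset.mem_biUnion.2 ⟨k, hk, hj⟩)) hjD))⟩)
        s (fun x hx => ⟨fun h => by
            by_cases hxC : x ∈ C
            · exact (hsu₁ x hx hxC).not_gt h.1
            · exact (hsv₁ x hx hxC).not_gt h.2,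
          fun h => by
            by_cases hxD : x ∈ D
            · exact (hsu₂ x hx hxD).not_gt h.1
            · exact (hsv₂ x hx hxD).not_gt h.2⟩)
    -- Transporting by `σ⁻¹` puts `b` and `d` back in place and changes the sequence instead.
    let τ := σ.symm
    have hτ : ∀ (r : α → M), (fun t => τ (σ (r t))) = r := fun r => funext fun t => by simp [τ]
    let a₁ : I → α → M := fun i => if i ∈ s then fun c => τ (a i c) else a i
    have ha₁ : ∀ i, E (a i) (a₁ i) := by
      intro i
      by_cases hi : i ∈ s
      · have := (hE.iff_aut τ _ _).2 (hσ i hi)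
        rw [hτ] at this
        simpa only [a₁, if_pos hi] using this
      · simpa only [a₁, if_neg hi] using E.refl' _
    let v : δ → M := fun q => Sum.elim (fun i => ![a i, a₁ i, a₁ i])
      (fun s => if s then ![d, fun c => τ (z c), fun c => τ (z' c)]
        else ![b, fun c => τ (y c), fun c => τ (y' c)]) q.1 q.2.1 q.2.2
    have hpτ : ∀ r r' : α → M, (∀ φ ∈ pF, φ.Realize (Sum.elim r r')) → ∀ φ ∈ pF,
        φ.Realize (Sum.elim (fun c => τ (r c)) (fun c => τ (r' c))) := by
      intro r r' h φ hφ
      refine (iff_of_eq (congrArg _ ?_)).1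
        (((isFormula_realize φ).iff_aut τ (Sum.elim r r')).2 (h φ hφ))
      funext q
      rcases q with q | q <;> rfl
    have hfill : ∀ {C' : Set I} (k : FillCond L C' α) (x : α → M), k.support ⊆ s →
        k.Holds a (fun o => o.elim x a) → k.Holds a (fun o => o.elim (fun c => τ (x c)) a₁) := by
      intro C' k x hk h
      refine (k.holds_congr a (x := fun o c => τ (o.elim x a c)) rfl fun i hi => ?_).1
        ((k.holds_aut a _ τ).2 h)
      simp only [Option.elim, a₁, if_pos (hk hi)]
    refine ⟨v, ?_, ?_⟩
    · rintro ⟨w, l, c⟩ (rfl : l = 0)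
      rcases w with i | (_ | _) <;> rfl
    · rintro (⟨w, t, e⟩ | k | k) hk
      · have hmem : e.1 ∈ pF := Finset.mem_image.2 ⟨(w, t, e), by simpa using hk, rfl⟩
        have real : ∀ r r' : α → M, e.1.Realize (Sum.elim r r') →
            (fun c => v (w, lo t, c)) = r → (fun c => v (w, hi t, c)) = r' →
              P (Sum.inl (w, t, e)) v := by
          rintro r r' h rfl rfl
          refine (iff_of_eq (congrArg e.1.Realize ?_)).1 h
          funext q
          rcases q with q | q <;> rfl
        rcases w with i | (_ | _) <;> rcases t with _ | _
        · exact hPE _ _ _ _ (ha₁ i)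
        · exact hPE _ _ _ _ (E.refl' _)
        · refine hPE _ _ _ _ (E.symm' ?_)
          have := (hE.iff_aut τ _ _).2 hy
          rw [hτ] at this
          exact this
        · exact real _ _ (hpτ _ _ hyy' _ hmem) rfl rfl
        · refine hPE _ _ _ _ (E.symm' ?_)
          have := (hE.iff_aut τ _ _).2 hz
          rw [hτ] at this
          exact this
        · exact real _ _ (hpτ _ _ hzz' _ hmem) rfl rfl
      · have hk' : k ∈ G₁ := by simpa [G₁] using hk
        change k.Holds a fun o c => v (point false o, 2, c)
        refine (iff_of_eq (congrArg (k.Holds a) ?_)).1 (hfill k y'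
          (fun i hi => Finset.mem_union_left _ (Finset.mem_biUnion.2 ⟨k, hk', hi⟩)) (hy' k hk'))
        funext o c
        rcases o with _ | i <;> rfl
      · have hk' : k ∈ G₂ := by simpa [G₂] using hk
        change k.Holds a fun o c => v (point true o, 2, c)
        refine (iff_of_eq (congrArg (k.Holds a) ?_)).1 (hfill k z'
          (fun i hi => Finset.mem_union_right _ (Finset.mem_biUnion.2 ⟨k, hk', hi⟩)) (hz' k hk'))
        funext o c
        rcases o with _ | i <;> rfl)
  have hvE : ∀ w s, E (fun c => v (w, lo s, c)) (fun c => v (w, hi s, c)) := by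
    intro w s
    refine (hp _ _).2 fun φ hφ => ?_
    refine (iff_of_eq (congrArg _ ?_)).1 (hv (Sum.inl (w, s, ⟨φ, hφ⟩)))
    funext q
    rcases q with q | q <;> rfl
  have hvE' : ∀ w, E (fun c => v (w, 2, c)) (fun c => f (w, 0, c)) := by
    intro w
    have h0 : (fun c => v (w, 0, c)) = fun c => f (w, 0, c) := funext fun c => hvf rfl
    rw [← h0]
    exact E.symm' (E.trans' (hvE w false) (hvE w true))
  refine ⟨fun i c => v (Sum.inl i, 2, c), fun c => v (Sum.inr false, 2, c),
    fun c => v (Sum.inr true, 2, c), fun i => hvE' (Sum.inl i), hvE' (Sum.inr false),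
    hvE' (Sum.inr true), fun n i j φ => ?_, fun n i j φ => ?_⟩
  · refine Iff.trans (iff_of_eq (congrArg _ ?_)) (hv (Sum.inr (Sum.inl ⟨n, i, j, φ⟩)))
    funext q
    refine (congrFun (fillSeq_eq _ _ _) q.2).trans ?_
    simp only [point]
    rcases old (i q.1) with _ | t <;> rfl
  · refine Iff.trans (iff_of_eq (congrArg _ ?_)) (hv (Sum.inr (Sum.inr ⟨n, i, j, φ⟩)))
    funext q
    refine (congrFun (fillSeq_eq _ _ _) q.2).trans ?_
    simp only [point]
    rcases old (i q.1) with _ | t <;> rfl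

end CommonLift

/-! ### Distality of quotients -/

section Quotients

variable {L : FirstOrder.Language.{u, v}} {M : Type w} [L.Structure M]

/-- The sequence `a` with the terms `b` and `d` inserted at the cuts `C` and `D`. -/
def fillSeq₂ {S I : Type*} (a : I → S) (C D : Set I) (b d : S) :
    C ⊕ₗ (Unit ⊕ₗ ((D \ C : Set I) ⊕ₗ (Unit ⊕ₗ (Dᶜ : Set I)))) → S :=
  concat (restrictTo a C) (concat (single b)
    (concat (restrictTo a (D \ C)) (concat (single d) (restrictTo a Dᶜ))))

theorem fillSeq₂_comp {S S' I : Type*} (h : S → S') (a : I → S) (C D : Set I) (b d : S) :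
    fillSeq₂ (fun i => h (a i)) C D (h b) (h d) = fun x => h (fillSeq₂ a C D b d x) := by
  unfold fillSeq₂
  simp only [← concat_comp]
  rfl

theorem fillSeq_comp {S S' I : Type*} (h : S → S') (a : I → S) (C : Set I) (b : S) :
    fillSeq (fun i => h (a i)) C (h b) = fun x => h (fillSeq a C b x) := by
  unfold fillSeq
  simp only [← concat_comp]
  rfl

theorem Indiscernible.aut {J : Type*} [LinearOrder J] {α : Type w} {a : J → α → M}
    (ha : Indiscernible (TupleTypeEq L) a) (σ : M ≃[L] M) :
    Indiscernible (TupleTypeEq L) (fun i c => σ (a i c)) := by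
  intro n i j φ
  exact ((isFormula_realize φ).iff_aut σ _).trans
    ((ha n i j φ).trans ((isFormula_realize φ).iff_aut σ _).symm)

/-- Images of distal sequences under type-definable equivalence relations are distal: both fillers
lift to fillers of one sequence conjugate to `a`, which is distal. -/
theorem IsDistal.quotient [Nonempty M] {κ : Cardinal.{w}} (hM : IsMonster L M κ)
    (hNIP : HasNIP L M) {α : Type w} (hα : #α < κ) {E : Setoid (α → M)} (hE : TypeDefinable L E)
    {I : Type w} [LinearOrder I] [DenselyOrdered I] (hI : #I < κ) {a : I → α → M}
    (h : IsDistal (TupleTypeEq L) a) :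
    IsDistal (HypTypeEq L E) (fun i => Quotient.mk E (a i)) := by
  obtain ⟨ha, hdist⟩ := h
  refine ⟨(indiscernible_mk_iff hE).2 (ha.classTypeEq hM hα hE fun _ => E.refl' _), ?_⟩
  intro C D hC hD hCD b d hb hd
  obtain ⟨b, rfl⟩ := Quotient.exists_rep b
  obtain ⟨d, rfl⟩ := Quotient.exists_rep d
  obtain ⟨a', b', d', ha', hb', hd', hC', hD'⟩ := exists_common_lift hM hNIP hα hE hI ha hC hD
    hCD ((fills_mk_iff hE).1 hb) ((fills_mk_iff hE).1 hd)
  have htype : ∀ (n : ℕ) (i : Fin n ↪o I),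
      TupleTypeEq L n (fun k => a (i k)) (fun k => a' (i k)) := by
    intro n i φ
    have := hC' n (i.trans (OrderEmbedding.ofStrictMono _ (place_strictMono hC.lower))) i φ
    simpa [fillSeq_eq] using this.symm
  obtain ⟨ρ, hρ⟩ := hM.exists_aut_of_typeEq hα hI htype
  have hρa : ∀ i, (fun c => ρ.symm (a' i c)) = a i := fun i => funext fun c => by
    rw [← hρ]; simp
  have hind : ∀ {C' : Set I}, IsDedekindCut C' → ∀ {x : α → M},
      (∀ (n : ℕ) (i : Fin n ↪o FillIndex C') (j : Fin n ↪o I),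
        TupleTypeEq L n (fun k => fillSeq a' C' x (i k)) (fun k => a (j k))) →
      Fills (TupleTypeEq L) a C' (fun c => ρ.symm (x c)) := by
    intro C' hC' x hx
    have h1 : Indiscernible (TupleTypeEq L) (fillSeq a' C' x) := by
      intro n i j φ
      obtain ⟨u, hu⟩ := hC'.left_nonempty
      obtain ⟨w, -, huw⟩ := hC'.left_no_max u hu
      obtain ⟨l, hl, -⟩ := exists_strictMono_mem_Ioo huw
      let e : Fin n ↪o I := OrderEmbedding.ofStrictMono (fun k : Fin n => l k)
        (hl.comp Fin.val_strictMono)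
      exact (hx n i e φ).trans (hx n j e φ).symm
    have h2 := h1.aut ρ.symm
    have e : fillSeq a C' (fun c => ρ.symm (x c)) = fun z c => ρ.symm (fillSeq a' C' x z c) :=
      (congrArg (fun r => fillSeq r C' _) (funext hρa).symm).trans
        (fillSeq_comp (fun (r : α → M) c => ρ.symm (r c)) a' C' x)
    change Indiscernible _ (fillSeq a C' fun c => ρ.symm (x c))
    rw [e]
    exact h2
  have h3 := (hdist C D hC hD hCD _ _ (hind hC hC') (hind hD hD')).aut ρ
  have e : (fun x c => ρ (fillSeq₂ a C D (fun c => ρ.symm (b' c)) (fun c => ρ.symm (d' c)) x c)) =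
      fillSeq₂ a' C D b' d' := by
    refine (fillSeq₂_comp (fun (r : α → M) c => ρ (r c)) a C D (fun c => ρ.symm (b' c))
      (fun c => ρ.symm (d' c))).symm.trans ?_
    simp only [FirstOrder.Language.Equiv.apply_symm_apply, hρ]
  have h4 : Indiscernible (TupleTypeEq L) (fillSeq₂ a' C D b' d') := e ▸ h3
  have h5 : Indiscernible (ClassTypeEq L E) (fillSeq₂ a C D b d) := by
    refine h4.classTypeEq hM hα hE ?_
    rintro (i | _ | i | _ | i)
    · exact ha' i
    · exact hb'
    · exact ha' i
    · exact hd'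
    · exact ha' i
  have h6 := (indiscernible_mk_iff hE).2 h5
  rw [← fillSeq₂_comp (Quotient.mk E)] at h6
  exact h6

end Quotients

/-! ### Ramsey's theorem -/

section Ramsey

/-- Ramsey's theorem for colourings of increasing tuples of natural numbers with two colours. -/
theorem exists_strictMono_homogeneous (n : ℕ) (P : (Fin n → ℕ) → Prop) :
    ∃ h : ℕ → ℕ, StrictMono h ∧ ∀ i j : Fin n → ℕ, StrictMono i → StrictMono j →
      (P (fun k => h (i k)) ↔ P (fun k => h (j k))) := by
  classical
  induction n with
  | zero =>
    exact ⟨id, strictMono_id, fun i j _ _ => by rw [Subsingleton.elim i j]⟩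
  | succ n ih =>
    let U : Ultrafilter ℕ := Filter.hyperfilter ℕ
    -- The colour of `v` followed by `U`-almost any number. An infinite set is found on which the
    -- colour of a tuple is that of its initial part under `P'`.
    let P' : (Fin n → ℕ) → Prop := fun v => ∀ᶠ x in (U : Filter ℕ), P (Fin.snoc v x)
    have hP' : ∀ v, ∀ᶠ x in (U : Filter ℕ), (P (Fin.snoc v x) ↔ P' v) := by
      intro v
      by_cases h : P' v
      · exact h.mono fun x hx => iff_of_true hx h
      · exact (Ultrafilter.eventually_not.2 h).mono fun x hx => iff_of_false hx h
    have hg : ∀ s : Finset ℕ, ∃ x, (∀ y ∈ s, y < x) ∧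
        ∀ v : Fin n → ℕ, (∀ k, v k ∈ s) → (P (Fin.snoc v x) ↔ P' v) := by
      intro s
      have h1 : ∀ᶠ x in (U : Filter ℕ), ∀ y ∈ s, y < x := by
        rw [Finset.eventually_all]
        intro y _
        exact Nat.hyperfilter_le_atTop (Filter.eventually_gt_atTop y)
      have h2 : ∀ᶠ x in (U : Filter ℕ), ∀ v ∈ Fintype.piFinset fun _ : Fin n => s,
          (P (Fin.snoc v x) ↔ P' v) := by
        rw [Finset.eventually_all]
        intro v _
        exact hP' v
      obtain ⟨x, hx1, hx2⟩ := (h1.and h2).exists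
      exact ⟨x, hx1, fun v hv => hx2 v (Fintype.mem_piFinset.2 hv)⟩
    choose g hg1 hg2 using hg
    let s : ℕ → Finset ℕ := fun m => Nat.rec ∅ (fun _ t => insert (g t) t) m
    have hs : Monotone s := monotone_nat_of_le_succ fun m => Finset.subset_insert _ _
    have hmem : ∀ k m, k < m → g (s k) ∈ s m := fun k m h =>
      hs (Nat.succ_le_of_lt h) (Finset.mem_insert_self _ _)
    have hmono : StrictMono fun m => g (s m) := fun k m h => hg1 _ _ (hmem k m h)
    obtain ⟨h, hh, hhom⟩ := ih fun v => P' fun k => g (s (v k))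
    have key : ∀ i : Fin (n + 1) → ℕ, StrictMono i →
        (P (fun k => g (s (h (i k)))) ↔ P' fun k => g (s (h (i k.castSucc)))) := by
      intro i hi
      have e : (fun k => g (s (h (i k)))) =
          Fin.snoc (α := fun _ => ℕ) (fun k : Fin n => g (s (h (i k.castSucc))))
            (g (s (h (i (Fin.last n))))) := by
        funext k
        refine Fin.lastCases ?_ (fun k => ?_) k <;> simp
      rw [e]
      exact hg2 _ _ fun k => hmem _ _ (hh (hi (Fin.castSucc_lt_last k)))
    refine ⟨fun m => g (s (h m)), hmono.comp hh, fun i j hi hj => ?_⟩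
    rw [key i hi, key j hj]
    exact hhom _ _ (hi.comp (Fin.strictMono_castSucc)) (hj.comp (Fin.strictMono_castSucc))

/-- Ramsey's theorem for finitely many colourings, of tuples of various lengths, at once. -/
theorem exists_strictMono_homogeneous_finset {K : Type*} (n : K → ℕ)
    (P : ∀ k, (Fin (n k) → ℕ) → Prop) (F : Finset K) :
    ∃ h : ℕ → ℕ, StrictMono h ∧ ∀ k ∈ F, ∀ i j : Fin (n k) → ℕ, StrictMono i → StrictMono j →
      (P k (fun t => h (i t)) ↔ P k (fun t => h (j t))) := by
  classical
  induction F using Finset.induction_on with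
  | empty => exact ⟨id, strictMono_id, by simp⟩
  | insert k F _ ih =>
    obtain ⟨h, hh, hF⟩ := ih
    obtain ⟨h', hh', hk⟩ := exists_strictMono_homogeneous (n k) fun v => P k fun t => h (v t)
    refine ⟨fun m => h (h' m), hh.comp hh', fun k' hk' i j hi hj => ?_⟩
    rcases Finset.mem_insert.1 hk' with rfl | hk'
    · exact hk i j hi hj
    · exact hF k' hk' _ _ (hh'.comp hi) (hh'.comp hj)

end Ramsey

/-! ### Lifting indiscernible sequences, and tuples of infinite length -/

section Lift

variable {L : FirstOrder.Language.{u, v}} {M : Type w} [L.Structure M] {α : Type w}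

/-- An indiscernible sequence of hyperimaginaries has an indiscernible sequence of
representatives. -/
theorem exists_indiscernible_lift [Nonempty M] {κ : Cardinal.{w}} (hM : IsMonster L M κ)
    (hα : #α < κ) {E : Setoid (α → M)} (hE : TypeDefinable L E) {I : Type w} [LinearOrder I]
    [DenselyOrdered I] (hI : #I < κ) {r : I → α → M} (hr : Indiscernible (ClassTypeEq L E) r) :
    ∃ a : I → α → M, Indiscernible (TupleTypeEq L) a ∧ ∀ i, E (a i) (r i) := by
  classical
  -- A densely ordered set with two elements contains an infinite increasing sequence.
  rcases subsingleton_or_nontrivial I with hsub | hnon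
  · refine ⟨r, fun n i j φ => ?_, fun i => E.refl' _⟩
    have e : (i : Fin n → I) = j := funext fun k => Subsingleton.elim _ _
    rw [e]
  obtain ⟨x, y, hxy⟩ := exists_pair_lt I
  obtain ⟨l, hl, -⟩ := exists_strictMono_mem_Ioo hxy
  have hE' := hE
  obtain ⟨p, hp⟩ := hE'
  let δ : Type w := I × Bool × α
  have hδ : #δ < κ := by
    have h0 := hM.aleph0_lt
    simp only [δ, mk_prod, lift_id, lift_uzero, mk_fintype, Fintype.card_bool, lift_natCast]
    exact mul_lt_of_lt h0.le hI (mul_lt_of_lt h0.le (natCast_lt_aleph0.trans h0) hα)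
  -- The variables `(i, true, _)` stand for the representative to be found, and `(i, false, _)` for
  -- `r i`.
  let Q := Σ n : ℕ, (Fin n ↪o I) × (Fin n ↪o I) × L.Formula (Fin n × α)
  let P : (I × p) ⊕ Q → (δ → M) → Prop := Sum.elim
    (fun k v => k.2.1.Realize fun q => v (k.1, Sum.elim (fun c => (true, c))
      (fun c => (false, c)) q))
    (fun k v => k.2.2.2.Realize (fun q => v (k.2.1 q.1, true, q.2)) ↔
      k.2.2.2.Realize (fun q => v (k.2.2.1 q.1, true, q.2)))
  have hP : ∀ k, IsFormula L (P k) := by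
    rintro (k | k)
    · exact (isFormula_realize k.2.1).reindex _
    · exact ((isFormula_realize k.2.2.2).reindex fun q => (k.2.1 q.1, true, q.2)).iff
        ((isFormula_realize k.2.2.2).reindex fun q => (k.2.2.1 q.1, true, q.2))
  obtain ⟨v, hvf, hv⟩ := hM.saturated.exists_forall hδ hP {q | q.2.1 = false}
      (fun q => r q.1 q.2.2) (by
    intro F
    let s : Finset I := F.toRight.biUnion fun k =>
      Finset.univ.image k.2.1 ∪ Finset.univ.image k.2.2.1
    obtain ⟨h, hh, hhom⟩ := exists_strictMono_homogeneous_finset (K := Q) (fun k => k.1)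
      (fun k t => k.2.2.2.Realize fun q => r (l (t q.1)) q.2) F.toRight
    let rk : I → ℕ := fun x => (s.filter (· < x)).card
    have hrk : StrictMonoOn rk s := by
      intro x hx y hy hxy
      refine Finset.card_lt_card (Finset.ssubset_iff_of_subset ?_ |>.2 ⟨x, ?_, ?_⟩)
      · exact fun z hz => Finset.mem_filter.2
          ⟨(Finset.mem_filter.1 hz).1, (Finset.mem_filter.1 hz).2.trans hxy⟩
      · exact Finset.mem_filter.2 ⟨hx, hxy⟩
      · simp
    obtain ⟨σ, hσ⟩ := hr.exists_aut_finset s (f := fun x => l (h (rk x)))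
      (fun x hx y hy hxy => hl (hh (hrk hx hy hxy))) strictMonoOn_id
    let a : I → α → M := fun i => if i ∈ s then fun c => σ (r (l (h (rk i))) c) else r i
    have ha : ∀ i, E (a i) (r i) := by
      intro i
      by_cases hi : i ∈ s
      · simp only [a, if_pos hi]
        exact hσ i hi
      · simp only [a, if_neg hi]
        exact E.refl' _
    refine ⟨fun q => if q.2.1 then a q.1 q.2.2 else r q.1 q.2.2, ?_, ?_⟩
    · rintro ⟨i, t, c⟩ (rfl : t = false)
      simp
    · rintro (⟨i, φ⟩ | ⟨n, i, j, φ⟩) hk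
      · refine (congrArg φ.1.Realize ?_).mp ((hp _ _).1 (ha i) φ.1 φ.2)
        funext q
        rcases q with q | q <;> simp
      · have hk' : (⟨n, i, j, φ⟩ : Q) ∈ F.toRight := by simpa using hk
        have red : ∀ i : Fin n ↪o I, (∀ t, i t ∈ s) →
            (φ.Realize (fun q => a (i q.1) q.2) ↔
              φ.Realize fun q => r (l (h (rk (i q.1)))) q.2) := by
          intro i hi
          rw [← (isFormula_realize φ).iff_aut σ fun q => r (l (h (rk (i q.1)))) q.2]
          refine iff_of_eq (congrArg _ ?_)
          funext q
          simp only [a, if_pos (hi q.1)]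
        have hi : ∀ t, i t ∈ s := fun t => Finset.mem_biUnion.2 ⟨_, hk',
          Finset.mem_union_left _ (Finset.mem_image_of_mem _ (Finset.mem_univ t))⟩
        have hj : ∀ t, j t ∈ s := fun t => Finset.mem_biUnion.2 ⟨_, hk',
          Finset.mem_union_right _ (Finset.mem_image_of_mem _ (Finset.mem_univ t))⟩
        have := hhom _ hk' (fun t => rk (i t)) (fun t => rk (j t))
          (fun t t' htt => hrk (hi t) (hi t') (i.strictMono htt))
          (fun t t' htt => hrk (hj t) (hj t') (j.strictMono htt))
        exact (red i hi).trans (this.trans (red j hj).symm))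
  refine ⟨fun i c => v (i, true, c), fun n i j φ => hv (Sum.inr ⟨n, i, j, φ⟩), fun i => ?_⟩
  refine (hp _ _).2 fun φ hφ => ?_
  refine (congrArg φ.Realize ?_).mp (hv (Sum.inl (i, ⟨φ, hφ⟩)))
  funext q
  rcases q with q | q
  · rfl
  · exact hvf rfl

variable {J : Type*} [LinearOrder J]

theorem Indiscernible.comp_coord {β : Type*} {a : J → β → M}
    (ha : Indiscernible (TupleTypeEq L) a) {m : ℕ} (f : Fin m → β) :
    Indiscernible (TupleTypeEq L) (fun i c => a i (f c)) := by
  intro n i j φ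
  have := ha n i j (φ.relabel (Prod.map id f))
  rw [FirstOrder.Language.Formula.realize_relabel,
    FirstOrder.Language.Formula.realize_relabel] at this
  exact this

/-- A sequence of infinite tuples is indiscernible if its sequences of finite subtuples are. -/
theorem Indiscernible.of_comp_coord {β : Type*} {a : J → β → M}
    (h : ∀ (m : ℕ) (f : Fin m → β), Indiscernible (TupleTypeEq L) (fun i c => a i (f c))) :
    Indiscernible (TupleTypeEq L) a := by
  classical
  intro n i j φ
  obtain ⟨V, hV⟩ := (isFormula_realize (M := M) φ).exists_support
  obtain ⟨m, f, g, hfg⟩ := exists_fin_retraction (V.image Prod.snd)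
  have key : ∀ i : Fin n ↪o J, (φ.relabel (Prod.map id g)).Realize
      (fun q => a (i q.1) (f q.2)) ↔ φ.Realize fun q => a (i q.1) q.2 := by
    intro i
    rw [FirstOrder.Language.Formula.realize_relabel]
    refine hV _ _ fun q hq => ?_
    simp [hfg q.2 (Finset.mem_image_of_mem _ hq)]
  exact (key i).symm.trans ((h m f n i j _).trans (key j))

/-- In a distal theory dense indiscernible sequences of infinite tuples are distal, too. -/
theorem IsDistalTheory.isDistal {κ : Cardinal.{w}} (hT : IsDistalTheory L M κ) {I : Type w}
    [LinearOrder I] [DenselyOrdered I] (hI : #I < κ) {β : Type*} {a : I → β → M}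
    (ha : Indiscernible (TupleTypeEq L) a) : IsDistal (TupleTypeEq L) a := by
  refine ⟨ha, fun C D hC hD hCD b d hb hd => Indiscernible.of_comp_coord fun m f => ?_⟩
  have hb' : Indiscernible (TupleTypeEq L) (fillSeq (fun i c => a i (f c)) C fun c => b (f c)) := by
    have h := Indiscernible.comp_coord (a := fillSeq a C b) hb f
    rwa [← fillSeq_comp (fun (x : β → M) c => x (f c)) a C b] at h
  have hd' : Indiscernible (TupleTypeEq L) (fillSeq (fun i c => a i (f c)) D fun c => d (f c)) := by
    have h := Indiscernible.comp_coord (a := fillSeq a D d) hd f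
    rwa [← fillSeq_comp (fun (x : β → M) c => x (f c)) a D d] at h
  have h := (hT m I hI _ (ha.comp_coord f)).2 C D hC hD hCD _ _ hb' hd'
  have e := fillSeq₂_comp (fun (x : β → M) c => x (f c)) a C D b d
  exact e ▸ h

end Lift

end HyperDistal

theorem mainTheorem1 {L : FirstOrder.Language.{u, v}} {M : Type w} [L.Structure M] [Nonempty M]
    (κ : Cardinal.{w}) (hM : HyperDistal.IsMonster L M κ) (hNIP : HyperDistal.HasNIP L M) :
    (∀ α : Type w, #α < κ →
      ∀ E : Setoid (α → M), HyperDistal.TypeDefinable L E →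
      ∀ (I : Type w) [LinearOrder I] [DenselyOrdered I], #I < κ →
      ∀ a : I → α → M,
        HyperDistal.IsDistal (HyperDistal.TupleTypeEq L) a →
        HyperDistal.IsDistal (HyperDistal.HypTypeEq L E) (fun i => Quotient.mk E (a i))) ∧
    (HyperDistal.IsDistalTheory L M κ → HyperDistal.IsDistalHeq L M κ) := by
  refine ⟨fun α hα E hE I _ _ hI a ha => ha.quotient hM hNIP hα hE hI,
    fun hT α hα E hE I _ _ hI e he => ?_⟩
  obtain ⟨r, rfl⟩ : ∃ r : I → α → M, e = fun i => Quotient.mk E (r i) :=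
    ⟨fun i => (e i).out, funext fun i => ((e i).out_eq).symm⟩
  obtain ⟨a, ha, har⟩ := HyperDistal.exists_indiscernible_lift hM hα hE hI
    ((HyperDistal.indiscernible_mk_iff hE).1 he)
  have e : (fun i => Quotient.mk E (r i)) = fun i => Quotient.mk E (a i) :=
    funext fun i => (Quotient.eq.2 (har i)).symm
  rw [e]
  exact (hT.isDistal hI ha).quotient hM hNIP hα hE hI
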